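/- All graphs are finite, simple, undirected and connected, and embeddings are cellular embeddings in closed surfaces, described combinatorially by a rotation system together with a signature in $\{1,-1\}$ on the edges (edges of signature $-1$ are called twisted); the facial walks are given by face traversal. An embedding is strong if every facial walk is a cycle. A graph $G$ is cyclically $4$-edge connected if there is no set $A\subseteq E(G)$ of at most three edges such that $G\setminus A$ has at least two connected components containing a cycle. Let $G$ be a cyclically $4$-edge connected cubic planar graph, embedded on the sphere by a rotation system $\rho$ without twisted edges, and let $f$ be a face of this embedding of length $2k$ with $k\ge 2$. Let $G^\ast$ be the dual graph, and let $H$ be the subgraph of $G^\ast$ whose vertices are the neighbours of the dual vertex $f$ and whose edges are the edges $\{v_i,v_{i+1}\}$, where $v_1,\dots,v_{2k}$ (indices modulo $2k$) are the faces that one meets across the consecutive edges of the boundary of $f$. Then $H$ is a cycle of length $2k$ in $G^\ast$, and the embedding of $G$ with rotation system $\rho$ whose twisted edges are exactly the edges of $G$ with dual edge in $H$ is a strong embedding of $G$ on the orientable surface of genus $k-1$. In particular, $G$ has a strong embedding on the orientable surface of genus $k-1$. -/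

import Mathlib

namespace StrongEmb

variable {V : Type*}

/-- `G` is cyclically `k`-edge connected: there is no set of at most `k - 1` edges whose deletion
leaves at least two connected components that contain a cycle. -/
def CyclicallyEdgeConnected (G : SimpleGraph V) (k : ℕ) : Prop :=
  ¬ ∃ A : Finset (Sym2 V), (A : Set (Sym2 V)) ⊆ G.edgeSet ∧ A.card < k ∧
    ∃ u v : V, ∃ c : (G.deleteEdges (A : Set (Sym2 V))).Walk u u,
      ∃ c' : (G.deleteEdges (A : Set (Sym2 V))).Walk v v,
        c.IsCycle ∧ c'.IsCycle ∧ ¬ (G.deleteEdges (A : Set (Sym2 V))).Reachable u v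

/-- A rotation system: at every vertex a cyclic ordering of the edges incident to it, given as a
permutation of the darts (oriented edges) whose cycles are exactly the sets of darts with a
common initial vertex. -/
structure RotationSystem (G : SimpleGraph V) where
  rot : Equiv.Perm G.Dart
  rot_sameCycle_iff : ∀ d d' : G.Dart, rot.SameCycle d d' ↔ d.fst = d'.fst

/-- A cellular embedding of a (connected) graph in a closed surface, described by a rotation
system and a signature. The edges with signature `-1` are the twisted edges. -/
structure Embedding (G : SimpleGraph V) extends RotationSystem G where
  signature : G.edgeSet → ℤˣ

namespace Embedding

variable {G : SimpleGraph V} (E : Embedding G)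

/-- The signature of the edge that underlies a dart. -/
def sgn (d : G.Dart) : ℤˣ := E.signature ⟨d.edge, d.edge_mem⟩

/-- One step of the face traversal algorithm. A state `(d, ε)` means that the dart `d` is about to
be traversed, along one of its two sides; `ε` records whether rotations are currently read
clockwise or anticlockwise. Traversing a twisted edge flips `ε`, and the walk continues with the
edge that comes next to the edge just used, in the current sense of rotation. -/
def next (x : G.Dart × ℤˣ) : G.Dart × ℤˣ :=
  ((E.rot ^ ((x.2 * E.sgn x.1 : ℤˣ) : ℤ)) x.1.symm, x.2 * E.sgn x.1)

/-- The same side of the same edge, traversed in the opposite direction. -/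
def rev (x : G.Dart × ℤˣ) : G.Dart × ℤˣ := (x.1.symm, -(x.2 * E.sgn x.1))

/-- The other side of the same edge, traversed in the same direction. -/
def otherSide (x : G.Dart × ℤˣ) : G.Dart × ℤˣ := (x.1, -x.2)

/-- The cells of the embedding, i.e. the facial walks up to starting point and direction. -/
def Face : Type _ := Quot fun x y : G.Dart × ℤˣ => y = E.next x ∨ y = E.rev x

/-- The cell that lies along the given side of the given dart. -/
def face (x : G.Dart × ℤˣ) : E.Face := Quot.mk _ x

/-- The facial walk starting in a given state, as the list of the darts traversed until the state
recurs for the first time. -/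
noncomputable def facialWalk (x : G.Dart × ℤˣ) : List G.Dart :=
  (List.iterate E.next x (Function.minimalPeriod E.next x)).map Prod.fst

/-- The embedding is strong: all facial walks are cycles of `G`. -/
def IsStrong : Prop :=
  ∀ x : G.Dart × ℤˣ, ∃ c : G.Walk x.1.fst x.1.fst, c.IsCycle ∧ c.darts = E.facialWalk x

/-- The surface is orientable: the rotations at the vertices can be oriented in such a way that
the edges between oppositely oriented vertices are exactly the twisted ones. -/
def IsOrientable : Prop :=
  ∃ o : V → ℤˣ, ∀ d : G.Dart, E.sgn d = o d.fst * o d.snd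

/-- The Euler characteristic `|V| - |E| + |F|` of the surface. -/
noncomputable def eulerChar : ℤ := (Nat.card V : ℤ) - Nat.card G.edgeSet + Nat.card E.Face

/-- The surface is the orientable surface of genus `g` (for a connected graph). -/
def IsOrientableOfGenus (g : ℕ) : Prop := E.IsOrientable ∧ E.eulerChar = 2 - 2 * (g : ℤ)

/-- The dual graph: its vertices are the cells of the embedding, and two different cells are
adjacent if they lie on the two sides of an edge of `G`. -/
def dual : SimpleGraph E.Face where
  Adj f g := f ≠ g ∧ ∃ x : G.Dart × ℤˣ, E.face x = f ∧ E.face (otherSide x) = g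
  symm := ⟨by
    rintro f g ⟨hne, x, rfl, rfl⟩
    exact ⟨hne.symm, otherSide x, rfl, by simp [otherSide]⟩⟩
  loopless := ⟨fun _ h => h.1 rfl⟩

/-- The subgraph of the dual graph around the dual vertex `f`: its vertices are the neighbours
of `f`, and its edges join the neighbours reached across any two consecutive edges of the
facial walk of `f`. -/
def link (f : E.Face) : E.dual.Subgraph where
  verts := {g | E.dual.Adj f g}
  Adj g h := E.dual.Adj f g ∧ E.dual.Adj f h ∧ E.dual.Adj g h ∧
    ∃ x : G.Dart × ℤˣ, E.face x = f ∧
      s(g, h) = s(E.face (otherSide x), E.face (otherSide (E.next x)))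
  adj_sub h := h.2.2.1
  edge_vert h := h.1
  symm := ⟨fun _ _ ⟨h₁, h₂, h₃, x, hx, he⟩ => ⟨h₂, h₁, h₃.symm, x, hx, Sym2.eq_swap.trans he⟩⟩

end Embedding

namespace RotationSystem

variable {G : SimpleGraph V} (R : RotationSystem G)

/-- The embedding with the given rotation system and without twisted edges. -/
def untwisted : Embedding G := { R with signature := fun _ => 1 }

/-- The rotation system describes an embedding of the (connected) graph on the sphere. -/
def IsPlanar : Prop := R.untwisted.IsOrientableOfGenus 0

open Classical in
/-- The embedding defined by a twisted subgraph `H` of the dual graph: an edge is twisted if and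
only if its dual edge belongs to `H`. -/
noncomputable def twist (H : R.untwisted.dual.Subgraph) : Embedding G :=
  { R with
    signature := fun e =>
      if ∃ d : G.Dart, d.edge = e ∧ H.Adj (R.untwisted.face (d, 1)) (R.untwisted.face (d, -1))
      then -1 else 1 }

end RotationSystem

end StrongEmb

/-! The dual of an edge lies in `link` exactly when one end of the edge is on the boundary of `f`
and the other is not (`link_adj_left_iff`). The signature is therefore the coboundary of `flip`
(`sgn_twist_link`). So the twisted embedding amounts to the untwisted one with the rotations at the
vertices of `f` reversed: it is orientable, and its cells are the cycles of `flipPerm`.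

Since the graph is cubic, these cycles can be read off. The boundary of `f` traversed backwards is
again a cell. A walk along an edge of `f` turns off at the end of that edge, runs around the
neighbour across the next edge of `f`, returns to `f` at the far end of that next edge and follows
the edge after it. Thus edges of `f` of one parity merge with neighbours of the other parity; as `f`
has even length, this gives two cells. Cells far from `f` stay as they were. The function `label`
names these cells, and `sameCycle_flipPerm_iff` proves that it describes the cycles. So `2k + 1`
cells are replaced by three, and the Euler characteristic becomes `2 - 2(k - 1)`. The embedding is
strong because darts with a common initial vertex have different labels (`label_rot_ne`).

The argument needs a dual without loops or parallel edges, whose triangles come only from vertices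
(`HasSimpleDual`). On the sphere a closed dual walk is a cut modulo two (`exists_potential`, a rank
count using Euler's formula), and cyclic connectivity turns every cut of at most three edges into a
vertex star (`eq_star_of_cut`). -/

namespace StrongEmb
open SimpleGraph

/-! ### Cycles from sequences of darts. -/

section Walks
variable {V : Type*} {G : SimpleGraph V}

theorem exists_walk_darts (s : ℕ → G.Dart) (hs : ∀ i, (s i).snd = (s (i + 1)).fst) (n : ℕ) :
    ∃ p : G.Walk (s 0).fst (s n).fst, p.darts = (List.range n).map s := by
  induction n with
  | zero => exact ⟨.nil, rfl⟩
  | succ n ih =>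
    obtain ⟨p, hp⟩ := ih
    refine ⟨(p.concat (s n).adj).copy rfl (hs n), ?_⟩
    simp [hp, List.range_succ]

/-- A closed sequence of consecutive darts with pairwise different initial vertices is a cycle. -/
theorem exists_isCycle_darts (s : ℕ → G.Dart) (hs : ∀ i, (s i).snd = (s (i + 1)).fst) {n : ℕ}
    (hn : 3 ≤ n) (hclosed : (s n).fst = (s 0).fst)
    (hinj : ∀ i < n, ∀ j < n, (s i).fst = (s j).fst → i = j) :
    ∃ c : G.Walk (s 0).fst (s 0).fst, c.IsCycle ∧ c.darts = (List.range n).map s := by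
  obtain ⟨p, hp⟩ := exists_walk_darts s hs n
  refine ⟨p.copy rfl hclosed, ?_, by simpa using hp⟩
  have hlen : p.length = n := by rw [← Walk.length_darts, hp]; simp
  rw [Walk.isCycle_iff_isPath_tail_and_le_length]
  refine ⟨?_, by simpa [hlen] using hn⟩
  have hnil : ¬ (p.copy rfl hclosed).Nil := by
    rw [← Walk.length_eq_zero_iff]; simp [hlen]; omega
  rw [Walk.isPath_def, Walk.support_tail_of_not_nil _ hnil, ← Walk.map_snd_darts]
  simp only [Walk.darts_copy, hp, List.map_map]
  refine (List.nodup_map_iff_inj_on List.nodup_range).2 ?_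
  intro i hi j hj hij
  simp only [List.mem_range] at hi hj
  simp only [Function.comp, hs] at hij
  -- Terminal vertices are initial vertices shifted by one, so index `n` has to be wrapped around to
  -- `0`.
  rcases Nat.lt_or_ge (i + 1) n with h1 | h1 <;> rcases Nat.lt_or_ge (j + 1) n with h2 | h2
  · have := hinj _ h1 _ h2 hij; omega
  · obtain rfl : j + 1 = n := by omega
    have := hinj _ h1 0 (by omega) (hij.trans hclosed); omega
  · obtain rfl : i + 1 = n := by omega
    have := hinj 0 (by omega) _ h2 (hclosed.symm.trans hij); omega
  · omega

end Walks

/-! ### Small edge cuts in cubic graphs. -/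

section Cuts
variable {V : Type*}

/-- A forest extends to a spanning tree of the complete graph. -/
theorem card_edgeSet_lt_of_isAcyclic [Fintype V] [Nonempty V] {G : SimpleGraph V}
    (h : G.IsAcyclic) : Nat.card G.edgeSet < Nat.card V := by
  obtain ⟨T, hle, -, hT⟩ :=
    (connected_top (V := V)).exists_isTree_le_of_le_of_isAcyclic le_top h
  rw [← (isTree_iff_connected_and_card.1 hT).2, Nat.lt_succ_iff]
  exact Nat.card_mono (Set.toFinite _) (edgeSet_mono hle)

/-- If one side of an edge cut of size at most three in a cubic graph contains no cycle, then the
cut is the star of a vertex. -/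
theorem eq_star_of_isAcyclic_induce [Fintype V] {G : SimpleGraph V} [DecidableRel G.Adj]
    (hcubic : G.IsRegularOfDegree 3) {X : Finset (Sym2 V)} (hcard : X.card ≤ 3) {S : Set V}
    (hS : S.Nonempty) (hX : ∀ d : G.Dart, d.fst ∈ S → d.snd ∉ S → d.edge ∈ X)
    (hXS : ∀ e ∈ X, ∃ v ∈ S, v ∈ e) (hac : (G.induce S).IsAcyclic) :
    X.card = 3 ∧ ∃ v, ∀ e ∈ X, v ∈ e := by
  classical
  have : Nonempty S := hS.to_subtype
  have hlt := card_edgeSet_lt_of_isAcyclic hac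
  have h1 : Nat.card {d : G.Dart // d.fst ∈ S} = 3 * Nat.card S := by
    have e : {d : G.Dart // d.fst ∈ S} ≃ Σ v : S, {d : G.Dart // d.fst = v} :=
      { toFun := fun d => ⟨⟨d.1.fst, d.2⟩, ⟨d.1, rfl⟩⟩
        invFun := fun p => ⟨p.2.1, by rw [p.2.2]; exact p.1.2⟩
        left_inv := fun d => rfl
        right_inv := by
          rintro ⟨⟨v, hv⟩, ⟨d, hd⟩⟩
          obtain rfl : d.fst = v := hd
          rfl }
    rw [Nat.card_congr e, Nat.card_sigma]
    have : ∀ v : S, Nat.card {d : G.Dart // d.fst = v} = 3 := by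
      intro v
      rw [Nat.card_eq_fintype_card, Fintype.card_subtype, G.dart_fst_fiber_card_eq_degree,
        hcubic v]
    simp only [this]
    simp [mul_comm]
  -- A dart from `S` either stays in `S` or crosses the cut, and a crossing edge has only one
  -- orientation that starts in `S`.
  have h2 : Nat.card {d : G.Dart // d.fst ∈ S} ≤ 2 * Nat.card (G.induce S).edgeSet + X.card := by
    have hd : Nat.card (G.induce S).Dart = 2 * Nat.card (G.induce S).edgeSet := by
      rw [Nat.card_eq_fintype_card, (G.induce S).dart_card_eq_twice_card_edges,
        Nat.card_eq_fintype_card, edgeFinset_card]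
    have hx : X.card = Nat.card X := by simp
    rw [← hd, hx, ← Nat.card_sum]
    let j : {d : G.Dart // d.fst ∈ S} → (G.induce S).Dart ⊕ X := fun d =>
      if h : d.1.snd ∈ S then .inl ⟨(⟨d.1.fst, d.2⟩, ⟨d.1.snd, h⟩), d.1.adj⟩
      else .inr ⟨d.1.edge, hX _ d.2 h⟩
    refine Nat.card_le_card_of_injective j ?_
    rintro ⟨d, hd⟩ ⟨d', hd'⟩ h
    by_cases hs : d.snd ∈ S <;> by_cases hs' : d'.snd ∈ S <;> simp only [j, hs, hs'] at h
    · simp only [dite_true, Sum.inl.injEq] at h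
      exact Subtype.ext (Dart.ext _ _
        (congrArg (fun d : (G.induce S).Dart => ((d.fst : V), (d.snd : V))) h))
    · simp at h
    · simp at h
    · simp only [dite_false, Sum.inr.injEq, Subtype.mk.injEq] at h
      rcases (dart_edge_eq_iff d d').1 h with rfl | rfl
      · rfl
      · exact absurd hd hs'
  -- The counts give `3|S| ≤ 2(|S| - 1) + 3`.
  have h3 : Nat.card S = 1 := by
    have : 0 < Nat.card S := Nat.card_pos
    omega
  refine ⟨by omega, ?_⟩
  obtain ⟨hsub, ⟨v⟩⟩ := Nat.card_eq_one_iff_unique.1 h3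
  refine ⟨v, fun e he => ?_⟩
  obtain ⟨w, hw, hwe⟩ := hXS e he
  have : (⟨w, hw⟩ : S) = v := Subsingleton.elim _ _
  rw [← this]; exact hwe

/-- In a cyclically `4`-edge connected cubic graph, every edge cut with at most three edges is the
star of a vertex. -/
theorem eq_star_of_cut [Fintype V] {G : SimpleGraph V} [DecidableRel G.Adj]
    (hcubic : G.IsRegularOfDegree 3) (hcyc : CyclicallyEdgeConnected G 4) {X : Finset (Sym2 V)}
    (hsub : (X : Set (Sym2 V)) ⊆ G.edgeSet) (hne : X.Nonempty) (hcard : X.card ≤ 3)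
    (s : V → ZMod 2) (hX : ∀ d : G.Dart, d.edge ∈ X ↔ s d.fst ≠ s d.snd) :
    X.card = 3 ∧ ∃ v, ∀ e ∈ X, v ∈ e := by
  by_contra hcon
  have htwo : ∀ a b c : ZMod 2, a ≠ b → c = a ∨ c = b := by decide
  have hcut : ∀ b : ZMod 2, ∀ e ∈ X, ∃ v ∈ {v | s v = b}, v ∈ e := by
    intro b e he
    have hG := hsub he
    induction e using Sym2.ind with
    | _ u v =>
      have := (hX ⟨(u, v), hG⟩).1 he
      rcases htwo _ _ b this with rfl | rfl
      · exact ⟨u, rfl, by simp⟩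
      · exact ⟨v, rfl, by simp⟩
  -- A side of the cut without a cycle would make the cut a star.
  have key : ∀ b : ZMod 2, ∃ u, s u = b ∧
      ∃ c : (G.deleteEdges (X : Set (Sym2 V))).Walk u u, c.IsCycle := by
    intro b
    by_contra hno
    obtain ⟨e, he⟩ := hne
    obtain ⟨w, hw, -⟩ := hcut b e he
    refine hcon (eq_star_of_isAcyclic_induce hcubic hcard ⟨w, hw⟩ ?_ (hcut b) ?_)
    · intro d h1 h2
      exact (hX d).2 fun h => h2 (h.symm.trans h1)
    · intro u c hc
      let F : G.induce {v | s v = b} →g G.deleteEdges (X : Set (Sym2 V)) :=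
        { toFun := Subtype.val
          map_rel' := by
            rintro ⟨a, ha⟩ ⟨a', ha'⟩ hadj
            refine (deleteEdges_adj).2 ⟨hadj, fun hmem => ?_⟩
            exact (hX ⟨(a, a'), hadj⟩).1 hmem (ha.trans ha'.symm) }
      exact hno ⟨u, u.2, c.map F, (Walk.isCycle_map_iff_of_injective Subtype.val_injective).2 hc⟩
  have hreach : ∀ u v, (G.deleteEdges (X : Set (Sym2 V))).Reachable u v → s u = s v := by
    rintro u v ⟨p⟩
    induction p with
    | nil => rfl
    | cons h p ih =>
      rw [← ih]
      obtain ⟨h1, h2⟩ := deleteEdges_adj.1 h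
      by_contra hs
      exact h2 ((hX ⟨(_, _), h1⟩).2 hs)
  obtain ⟨u, hu, c, hc⟩ := key 0
  obtain ⟨v, hv, c', hc'⟩ := key 1
  refine hcyc ⟨X, hsub, by omega, u, v, c, c', hc, hc', fun h => ?_⟩
  have := hreach _ _ h
  rw [hu, hv] at this
  exact absurd this (by decide)

end Cuts

/-! ### Rotations at vertices of degree three. -/

namespace RotationSystem
variable {V : Type*} {G : SimpleGraph V} (R : RotationSystem G)

theorem rot_zpow_fst (n : ℤ) (d : G.Dart) : ((R.rot ^ n) d).fst = d.fst :=
  ((R.rot_sameCycle_iff _ _).1 ⟨n, rfl⟩).symm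

theorem rot_fst (d : G.Dart) : (R.rot d).fst = d.fst := R.rot_zpow_fst 1 d

section Cubic
variable [Fintype V] [DecidableRel G.Adj]

theorem card_darts_at (hcubic : G.IsRegularOfDegree 3) (v : V) :
    Nat.card {d : G.Dart // d.fst = v} = 3 := by
  classical
  rw [Nat.card_eq_fintype_card, Fintype.card_subtype, G.dart_fst_fiber_card_eq_degree, hcubic v]

/-- Otherwise the cycle of `rot` through `d` would have at most two elements, but three darts leave
the vertex. -/
theorem rot_ne_and_rot_rot_ne (hcubic : G.IsRegularOfDegree 3) (d : G.Dart) :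
    R.rot d ≠ d ∧ R.rot (R.rot d) ≠ d := by
  classical
  by_contra hcon
  have h2 : R.rot (R.rot d) = d := by
    by_contra h
    refine hcon ⟨fun h1 => h ?_, h⟩
    rw [h1, h1]
  have hall : ∀ n : ℕ, (R.rot ^ n) d = d ∨ (R.rot ^ n) d = R.rot d := by
    intro n
    induction n with
    | zero => simp
    | succ n ih =>
      rw [pow_succ', Equiv.Perm.mul_apply]
      rcases ih with h | h <;> rw [h]
      · exact .inr rfl
      · exact .inl h2
  have h3 := card_darts_at (G := G) hcubic d.fst
  have hle : Nat.card {e : G.Dart // e.fst = d.fst} ≤ ({d, R.rot d} : Finset G.Dart).card := by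
    rw [Nat.card_eq_fintype_card, Fintype.card_subtype]
    refine Finset.card_le_card fun e he => ?_
    have he' : e.fst = d.fst := by simpa using he
    obtain ⟨n, hn⟩ := ((R.rot_sameCycle_iff d e).2 he'.symm).exists_nat_pow_eq
    rcases hall n with h | h <;> simp [← hn, h]
  have := Finset.card_le_two (a := d) (b := R.rot d)
  omega

theorem eq_or_eq_rot_of_fst_eq (hcubic : G.IsRegularOfDegree 3) {d e : G.Dart}
    (h : e.fst = d.fst) : e = d ∨ e = R.rot d ∨ e = R.rot (R.rot d) := by
  classical
  obtain ⟨h1, h2⟩ := R.rot_ne_and_rot_rot_ne hcubic d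
  have h3 : ({d, R.rot d, R.rot (R.rot d)} : Finset G.Dart).card = 3 := by
    rw [Finset.card_eq_three]
    exact ⟨_, _, _, h1.symm, h2.symm, fun h => h1 (R.rot.injective h).symm, rfl⟩
  have hsub : ({d, R.rot d, R.rot (R.rot d)} : Finset G.Dart) ⊆
      Finset.univ.filter fun e => e.fst = d.fst := by
    intro e he
    simp only [Finset.mem_insert, Finset.mem_singleton] at he
    rcases he with rfl | rfl | rfl <;> simp [rot_fst]
  have heq := Finset.eq_of_subset_of_card_le hsub (by
    rw [h3, G.dart_fst_fiber_card_eq_degree, hcubic])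
  have : e ∈ Finset.univ.filter fun e : G.Dart => e.fst = d.fst := by simpa using h
  rw [← heq] at this
  simpa using this

theorem rot_rot_rot (hcubic : G.IsRegularOfDegree 3) (d : G.Dart) :
    R.rot (R.rot (R.rot d)) = d := by
  obtain ⟨h1, h2⟩ := R.rot_ne_and_rot_rot_ne hcubic d
  rcases R.eq_or_eq_rot_of_fst_eq hcubic (d := d) (e := R.rot (R.rot (R.rot d)))
    (by simp [rot_fst]) with h | h | h
  · exact h
  · exact absurd (R.rot.injective h) h2
  · exact absurd (R.rot.injective (R.rot.injective h)) h1

theorem rot_inv_eq (hcubic : G.IsRegularOfDegree 3) (d : G.Dart) :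
    R.rot⁻¹ d = R.rot (R.rot d) := by
  rw [Equiv.Perm.inv_eq_iff_eq, R.rot_rot_rot hcubic]

theorem eq_or_eq_rot_or_rot_eq (hcubic : G.IsRegularOfDegree 3) {d e : G.Dart}
    (h : e.fst = d.fst) : e = d ∨ e = R.rot d ∨ R.rot e = d := by
  rcases R.eq_or_eq_rot_of_fst_eq hcubic h with h | h | h
  · exact .inl h
  · exact .inr (.inl h)
  · exact .inr (.inr (by rw [h, R.rot_rot_rot hcubic]))

end Cubic
end RotationSystem

/-! ### Cells of an oriented embedding as cycles of a permutation. -/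

namespace Embedding
variable {V : Type*} {G : SimpleGraph V} (E : Embedding G) (o : V → ℤˣ)

/-- The face permutation of the rotation system in which the cyclic orders at the vertices with
`o v = -1` are reversed. -/
def faceStep : Equiv.Perm G.Dart where
  toFun d := (E.rot ^ ((o d.snd : ℤˣ) : ℤ)) d.symm
  invFun d := ((E.rot ^ (-((o d.fst : ℤˣ) : ℤ))) d).symm
  left_inv d := by
    have : ((E.rot ^ ((o d.snd : ℤˣ) : ℤ)) d.symm).fst = d.snd := E.rot_zpow_fst _ _
    simp only [this, ← Equiv.Perm.mul_apply, ← zpow_add]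
    simp
  right_inv d := by
    have : ((E.rot ^ (-((o d.fst : ℤˣ) : ℤ))) d).symm.snd = d.fst := E.rot_zpow_fst _ _
    simp only [this, Dart.symm_symm, ← Equiv.Perm.mul_apply, ← zpow_add]
    simp

theorem faceStep_apply (d : G.Dart) :
    E.faceStep o d = (E.rot ^ ((o d.snd : ℤˣ) : ℤ)) d.symm := rfl

theorem faceStep_inv_apply (d : G.Dart) :
    (E.faceStep o)⁻¹ d = ((E.rot ^ (-((o d.fst : ℤˣ) : ℤ))) d).symm := rfl

theorem faceStep_fst (d : G.Dart) : (E.faceStep o d).fst = d.snd := E.rot_zpow_fst _ _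

/-- The sense in which a state traverses the cell on its side, with respect to `o`. -/
def sense (x : G.Dart × ℤˣ) : ℤˣ := x.2 * o x.1.fst

/-- The dart that traverses the side of a state in the positive sense with respect to `o`. -/
def posDart (x : G.Dart × ℤˣ) : G.Dart := if sense o x = 1 then x.1 else x.1.symm

variable {o}

theorem eq_of_posDart_eq {x y : G.Dart × ℤˣ} (h1 : sense o x = sense o y)
    (h2 : posDart o x = posDart o y) : x = y := by
  have hd : x.1 = y.1 := by
    unfold posDart at h2
    rw [h1] at h2
    split_ifs at h2
    · exact h2
    · exact Dart.symm_involutive.injective h2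
  refine Prod.ext hd ?_
  simpa [sense, hd] using h1

theorem exists_sense_eq_one (d : G.Dart) : sense o (d, o d.fst) = 1 := by
  simp [sense, ← sq, Int.units_sq]

theorem posDart_eq (d : G.Dart) : posDart o (d, o d.fst) = d := by
  simp [posDart, exists_sense_eq_one]

theorem next_fst_fst (x : G.Dart × ℤˣ) : (E.next x).1.fst = x.1.snd := E.rot_zpow_fst _ _

variable {E}

theorem sense_next (ho : ∀ d : G.Dart, E.sgn d = o d.fst * o d.snd) (x : G.Dart × ℤˣ) :
    sense o (E.next x) = sense o x := by
  rw [sense, next_fst_fst, next, ho, sense, mul_assoc, mul_assoc, ← sq, Int.units_sq, mul_one]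

/-- States of positive sense run the face permutation forwards, states of negative sense run it
backwards. -/
theorem posDart_next (ho : ∀ d : G.Dart, E.sgn d = o d.fst * o d.snd) (x : G.Dart × ℤˣ) :
    posDart o (E.next x) = (E.faceStep o ^ ((sense o x : ℤˣ) : ℤ)) (posDart o x) := by
  have hs : x.2 * E.sgn x.1 = sense o x * o x.1.snd := by rw [ho, sense, mul_assoc]
  rw [posDart, sense_next ho]
  rcases Int.units_eq_one_or (sense o x) with h | h
  · simp [h, posDart, next, hs, faceStep_apply]
  · have : (-1 : ℤˣ) ≠ 1 := by decide
    simp only [h, posDart, next, hs, this, if_false]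
    simp [faceStep_inv_apply]

theorem sense_rev (ho : ∀ d : G.Dart, E.sgn d = o d.fst * o d.snd) (x : G.Dart × ℤˣ) :
    sense o (E.rev x) = -sense o x := by
  have h : (E.rev x).1.fst = x.1.snd := rfl
  rw [sense, h, rev, ho, sense, neg_mul, mul_assoc, mul_assoc, ← sq, Int.units_sq, mul_one]

theorem posDart_rev (ho : ∀ d : G.Dart, E.sgn d = o d.fst * o d.snd) (x : G.Dart × ℤˣ) :
    posDart o (E.rev x) = posDart o x := by
  have : (-1 : ℤˣ) ≠ 1 := by decide
  rw [posDart, sense_rev ho, posDart]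
  rcases Int.units_eq_one_or (sense o x) with h | h <;> simp [h, rev, this]

theorem sense_iterate (ho : ∀ d : G.Dart, E.sgn d = o d.fst * o d.snd) (x : G.Dart × ℤˣ)
    (n : ℕ) : sense o (E.next^[n] x) = sense o x := by
  induction n with
  | zero => rfl
  | succ n ih => rw [Function.iterate_succ_apply', sense_next ho, ih]

theorem posDart_iterate (ho : ∀ d : G.Dart, E.sgn d = o d.fst * o d.snd) (x : G.Dart × ℤˣ)
    (n : ℕ) : posDart o (E.next^[n] x) =
      (E.faceStep o ^ (((sense o x : ℤˣ) : ℤ) * n)) (posDart o x) := by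
  induction n with
  | zero => simp
  | succ n ih =>
    rw [Function.iterate_succ_apply', posDart_next ho, sense_iterate ho, ih,
      ← Equiv.Perm.mul_apply, ← zpow_add]
    congr 2
    push_cast
    ring

theorem next_injective (ho : ∀ d : G.Dart, E.sgn d = o d.fst * o d.snd) :
    Function.Injective E.next := by
  intro x y h
  have hs : sense o x = sense o y := by rw [← sense_next ho, h, sense_next ho]
  refine eq_of_posDart_eq hs ?_
  have := posDart_next ho x
  rw [h, posDart_next ho, hs] at this
  exact ((E.faceStep o ^ ((sense o y : ℤˣ) : ℤ)).injective this).symm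

theorem minimalPeriod_next (ho : ∀ d : G.Dart, E.sgn d = o d.fst * o d.snd)
    (x : G.Dart × ℤˣ) :
    Function.minimalPeriod E.next x =
      Function.minimalPeriod (E.faceStep o) (posDart o x) := by
  rw [Function.minimalPeriod_eq_minimalPeriod_iff]
  intro n
  have h1 : Function.IsPeriodicPt E.next n x ↔
      (E.faceStep o ^ (((sense o x : ℤˣ) : ℤ) * n)) (posDart o x) = posDart o x := by
    rw [← posDart_iterate ho]
    exact ⟨fun h => congrArg _ h, eq_of_posDart_eq (sense_iterate ho x n)⟩
  rw [h1, Function.IsPeriodicPt, Function.IsFixedPt, Equiv.Perm.iterate_eq_pow]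
  rcases Int.units_eq_one_or (sense o x) with h | h
  · simp [h]
  · simp only [h, Units.val_neg, Units.val_one, neg_mul, one_mul, zpow_neg, zpow_natCast]
    rw [Equiv.Perm.inv_eq_iff_eq, eq_comm]

/-- The cells of an oriented embedding correspond to the cycles of the face permutation. -/
theorem face_eq_iff (ho : ∀ d : G.Dart, E.sgn d = o d.fst * o d.snd) (x y : G.Dart × ℤˣ) :
    E.face x = E.face y ↔ (E.faceStep o).SameCycle (posDart o x) (posDart o y) := by
  constructor
  · intro h
    let g : E.Face → Quotient (Equiv.Perm.SameCycle.setoid (E.faceStep o)) :=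
      Quot.lift (fun x => ⟦posDart o x⟧) (by
        rintro x y (rfl | rfl)
        · refine Quotient.sound (?_ : Equiv.Perm.SameCycle _ _ _)
          rw [posDart_next ho, Equiv.Perm.sameCycle_zpow_right]
        · rw [posDart_rev ho])
    exact Quotient.exact (congrArg g h)
  -- Either the state or its reverse has positive sense, and both lie on the same cell.
  · have hpos : ∀ x, E.face x = E.face (posDart o x, o (posDart o x).fst) := by
      intro x
      rcases Int.units_eq_one_or (sense o x) with h | h
      · congr 1
        refine eq_of_posDart_eq ?_ (posDart_eq _).symm
        rw [h, exists_sense_eq_one]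
      · have : E.face x = E.face (E.rev x) := Quot.sound (.inr rfl)
        rw [this]
        congr 1
        refine eq_of_posDart_eq ?_ (by rw [posDart_rev ho, posDart_eq])
        rw [sense_rev ho, h, exists_sense_eq_one, neg_neg]
    have hstep : ∀ d, E.face (d, o d.fst) =
        E.face (E.faceStep o d, o (E.faceStep o d).fst) := by
      intro d
      have : E.face (d, o d.fst) = E.face (E.next (d, o d.fst)) := Quot.sound (.inl rfl)
      rw [this]
      congr 1
      refine eq_of_posDart_eq (o := o) ?_ ?_
      · rw [sense_next ho, exists_sense_eq_one, exists_sense_eq_one]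
      · rw [posDart_next ho, exists_sense_eq_one, posDart_eq, posDart_eq]; rfl
    rintro ⟨n, hn⟩
    rw [hpos x, hpos y, ← hn]
    clear hn
    generalize posDart o x = d
    induction n using Int.induction_on with
    | zero => rfl
    | succ n ih => rw [ih, hstep, add_comm, zpow_add, zpow_one, Equiv.Perm.mul_apply]
    | pred n ih =>
      rw [ih, hstep ((E.faceStep o ^ (-(n : ℤ) - 1)) d), ← Equiv.Perm.mul_apply, ← zpow_one_add,
        add_sub_cancel]

/-- The number of cells is the number of values of a function on darts whose fibres are the
cycles of the face permutation. -/
theorem card_face_eq (ho : ∀ d : G.Dart, E.sgn d = o d.fst * o d.snd) {β : Type*}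
    (J : G.Dart → β) (hJ : Function.Surjective J)
    (hcyc : ∀ d d', (E.faceStep o).SameCycle d d' ↔ J d = J d') :
    Nat.card E.Face = Nat.card β := by
  have hface : ∀ x y, E.face x = E.face y ↔ J (posDart o x) = J (posDart o y) := fun x y => by
    rw [face_eq_iff ho, hcyc]
  let g : E.Face → β := Quot.lift (fun x => J (posDart o x)) fun x y h =>
    (hface x y).1 (Quot.sound h)
  refine Nat.card_congr (Equiv.ofBijective g ⟨?_, ?_⟩)
  · rintro ⟨x⟩ ⟨y⟩ h
    exact (hface x y).2 h
  · intro b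
    obtain ⟨d, rfl⟩ := hJ b
    exact ⟨E.face (d, o d.fst), congrArg J (posDart_eq d)⟩

/-- An oriented embedding of a cubic graph is strong if no cell passes twice through the same
vertex. -/
theorem isStrong_of_injective [Fintype V] [DecidableRel G.Adj] (hcubic : G.IsRegularOfDegree 3)
    (ho : ∀ d : G.Dart, E.sgn d = o d.fst * o d.snd)
    (h : ∀ d d', (E.faceStep o).SameCycle d d' → d.fst = d'.fst → d = d') : E.IsStrong := by
  intro x
  have hper := (next_injective ho).mem_periodicPts x
  have hiter := Function.iterate_minimalPeriod (f := E.next) (x := x)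
  set n := Function.minimalPeriod E.next x with hn
  have hn0 : 0 < n := Function.minimalPeriod_pos_of_mem_periodicPts hper
  have hn1 : n ≠ 1 := by
    intro h1
    have h2 := next_fst_fst E x
    rw [h1] at hiter
    rw [show E.next x = x from hiter] at h2
    exact x.1.fst_ne_snd h2
  -- Period two would mean turning back along the first edge, so the rotation would fix a dart.
  have hn2 : n ≠ 2 := by
    intro h1
    rw [h1] at hiter
    have h2 := next_fst_fst E (E.next x)
    rw [show E.next (E.next x) = x from hiter] at h2
    have h3 : (E.next x).1 = x.1.symm :=
      Dart.ext _ _ (Prod.ext (next_fst_fst E x) h2.symm)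
    rw [next] at h3
    have h4 := (E.rot_ne_and_rot_rot_ne hcubic x.1.symm).1
    rcases Int.units_eq_one_or (x.2 * E.sgn x.1) with h | h
    · simp only [h, Units.val_one, zpow_one] at h3
      exact h4 h3
    · simp only [h, Units.val_neg, Units.val_one, zpow_neg, zpow_one] at h3
      exact h4 (Equiv.Perm.inv_eq_iff_eq.1 h3).symm
  obtain ⟨c, hc, hd⟩ := exists_isCycle_darts (fun i => (E.next^[i] x).1)
    (fun i => by rw [Function.iterate_succ_apply', next_fst_fst]) (n := n) (by omega)
    (by simp only [hiter]; rfl) (by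
      intro i hi j hj hij
      refine (Function.iterate_eq_iterate_iff_of_lt_minimalPeriod hi hj).1 ?_
      have hs : sense o (E.next^[i] x) = sense o (E.next^[j] x) := by
        rw [sense_iterate ho, sense_iterate ho]
      refine eq_of_posDart_eq hs ?_
      have hcy : (E.faceStep o).SameCycle (posDart o (E.next^[i] x))
          (posDart o (E.next^[j] x)) := by
        rw [posDart_iterate ho, posDart_iterate ho, Equiv.Perm.sameCycle_zpow_left,
          Equiv.Perm.sameCycle_zpow_right]
      by_cases hpos : sense o (E.next^[i] x) = 1
      · refine h _ _ hcy ?_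
        rw [posDart, posDart, ← hs, if_pos hpos, if_pos hpos]
        exact hij
      -- In the negative sense the positive darts agree in their terminal vertices; one face step
      -- makes these initial.
      · refine (E.faceStep o).injective (h _ _ ?_ ?_)
        · rwa [Equiv.Perm.sameCycle_apply_left, Equiv.Perm.sameCycle_apply_right]
        · rw [faceStep_fst, faceStep_fst, posDart, posDart, ← hs, if_neg hpos, if_neg hpos]
          exact hij)
  refine ⟨c, hc, hd.trans ?_⟩
  refine List.ext_getElem (by simp [facialWalk, hn]) fun i h1 h2 => ?_
  simp [facialWalk, List.getElem_iterate]

end Embedding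

/-! ### The embedding without twisted edges. -/

namespace RotationSystem
variable {V : Type*} {G : SimpleGraph V} (R : RotationSystem G)

/-- The face permutation of the embedding without twisted edges. -/
def facePerm : Equiv.Perm G.Dart := R.untwisted.faceStep fun _ => 1

/-- The cell on the left hand side of a dart, in the embedding without twisted edges. -/
def left (d : G.Dart) : R.untwisted.Face := R.untwisted.face (d, 1)

theorem facePerm_apply (d : G.Dart) : R.facePerm d = R.rot d.symm := rfl

theorem facePerm_fst (d : G.Dart) : (R.facePerm d).fst = d.snd := R.rot_fst _

theorem sgn_untwisted (d : G.Dart) : R.untwisted.sgn d = 1 * 1 := rfl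

theorem left_eq_iff {d d' : G.Dart} : R.left d = R.left d' ↔ R.facePerm.SameCycle d d' := by
  have := Embedding.face_eq_iff (o := fun _ => 1) R.sgn_untwisted (d, 1) (d', 1)
  rwa [Embedding.posDart_eq, Embedding.posDart_eq] at this

theorem face_eq_left (x : G.Dart × ℤˣ) :
    R.untwisted.face x = R.left (Embedding.posDart (fun _ => 1) x) := by
  rw [left, Embedding.face_eq_iff (o := fun _ => 1) R.sgn_untwisted, Embedding.posDart_eq]

theorem face_neg (d : G.Dart) : R.untwisted.face (d, -1) = R.left d.symm := by
  have : (-1 : ℤˣ) ≠ 1 := by decide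
  rw [face_eq_left, Embedding.posDart, if_neg]
  simp [Embedding.sense, this]

theorem left_surjective : Function.Surjective R.left := by
  rintro ⟨x⟩
  exact ⟨_, (R.face_eq_left x).symm⟩

theorem left_facePerm (d : G.Dart) : R.left (R.facePerm d) = R.left d := by
  rw [left_eq_iff, Equiv.Perm.sameCycle_apply_left]

theorem left_rot (d : G.Dart) : R.left (R.rot d) = R.left d.symm := by
  rw [← R.left_facePerm d.symm, facePerm_apply, Dart.symm_symm]

instance [Finite V] : Finite R.untwisted.Face := by
  classical
  have : Fintype V := Fintype.ofFinite V
  exact Finite.of_surjective _ R.left_surjective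

/-- In a connected graph, rotation and reversal connect all darts. Applied to functions of the cell
on the left, this says that the dual is connected. -/
theorem eq_of_forall_rot_symm {β : Type*} (hconn : G.Connected) {z : G.Dart → β}
    (h1 : ∀ d, z (R.rot d) = z d) (h2 : ∀ d, z d.symm = z d) (d d' : G.Dart) : z d = z d' := by
  have hz : ∀ n : ℤ, ∀ d, z ((R.rot ^ n) d) = z d := by
    intro n
    induction n using Int.induction_on with
    | zero => intro d; rfl
    | succ n ih => intro d; rw [zpow_add_one, Equiv.Perm.mul_apply, ih, h1]
    | pred n ih =>
      intro d
      rw [zpow_sub_one, Equiv.Perm.mul_apply, ih, ← h1,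
        ← Equiv.Perm.mul_apply, mul_inv_cancel, Equiv.Perm.one_apply]
  have hv : ∀ d d' : G.Dart, d.fst = d'.fst → z d = z d' := by
    intro d d' h
    obtain ⟨n, rfl⟩ := (R.rot_sameCycle_iff d d').2 h
    exact (hz n d).symm
  obtain ⟨p⟩ := hconn.preconnected d.fst d'.fst
  have : ∀ u v (p : G.Walk u v) (d d' : G.Dart), d.fst = u → d'.fst = v → z d = z d' := by
    intro u v p
    induction p with
    | nil => intro d d' h h'; exact hv _ _ (h.trans h'.symm)
    | cons h p ih =>
      intro d d' hd hd'
      rw [hv d ⟨(_, _), h⟩ hd, ← h2]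
      exact ih _ d' rfl hd'
  exact this _ _ p d d' rfl rfl

/-! ### Homology of the sphere modulo two. -/

section Homology
variable [Fintype V] [DecidableRel G.Adj]

/-- The edge that underlies a dart, as an element of the edge set. -/
def toEdge (d : G.Dart) : G.edgeSet := ⟨d.edge, d.edge_mem⟩

theorem sum_darts_over_edge {M : Type*} [AddCommMonoid M] [DecidableEq G.edgeSet] (d : G.Dart)
    (h : G.Dart → M) : ∑ e : G.Dart with toEdge e = toEdge d, h e = h d + h d.symm := by
  classical
  have := d.edge_fiber
  simp only [toEdge, Subtype.mk.injEq]
  rw [← Finset.sum_pair d.symm_ne.symm]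
  refine Finset.sum_congr ?_ fun _ _ => rfl
  ext e
  simp [dart_edge_eq_iff]

theorem finrank_ker_le_one {K W : Type*} {ι : Type*} [Field K] [AddCommGroup W] [Module K W]
    (T : (ι → K) →ₗ[K] W) (hT : ∀ z, T z = 0 → ∀ i j, z i = z j) :
    Module.finrank K (LinearMap.ker T) ≤ 1 := by
  have hle : LinearMap.ker T ≤ Submodule.span K {(fun _ => 1 : ι → K)} := by
    intro z hz
    rw [Submodule.mem_span_singleton]
    rcases isEmpty_or_nonempty ι with h | ⟨⟨i⟩⟩
    · exact ⟨0, Subsingleton.elim _ _⟩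
    · exact ⟨z i, funext fun j => by simpa using hT z hz i j⟩
  refine (Submodule.finrank_mono hle).trans ?_
  simpa using finrank_span_le_card (R := K) {(fun _ => 1 : ι → K)}

/-- On the sphere, a `ZMod 2`-valued function on the edges that sums to zero around every cell is
the coboundary of a function on the vertices. -/
theorem exists_potential (hconn : G.Connected) (hR : R.IsPlanar) (c : Sym2 V → ZMod 2)
    (hc : ∀ z : R.untwisted.Face → ZMod 2, ∑ d : G.Dart, z (R.left d) * c d.edge = 0) :
    ∃ s : V → ZMod 2, ∀ d : G.Dart, c d.edge = s d.fst + s d.snd := by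
  classical
  have := Fintype.ofFinite R.untwisted.Face
  -- `N` is the coboundary from vertices to edges, and `M` sums an edge function around each cell.
  let N : Matrix G.edgeSet V (ZMod 2) := fun e v =>
    ∑ d : G.Dart with toEdge d = e, if d.fst = v then 1 else 0
  let M : Matrix R.untwisted.Face G.edgeSet (ZMod 2) := fun F e =>
    ∑ d : G.Dart with toEdge d = e, if R.left d = F then 1 else 0
  have hN : ∀ s (d : G.Dart), N.mulVec s (toEdge d) = s d.fst + s d.snd := by
    intro s d
    simp only [Matrix.mulVec, dotProduct, N, sum_darts_over_edge, add_mul, ite_mul, one_mul,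
      zero_mul, Finset.sum_add_distrib, Finset.sum_ite_eq, Finset.mem_univ, if_true]
    rfl
  have hMT : ∀ z (e : G.edgeSet), M.transpose.mulVec z e =
      ∑ d : G.Dart with toEdge d = e, z (R.left d) := by
    intro z e
    change ∑ F, (∑ d : G.Dart with toEdge d = e, if R.left d = F then (1 : ZMod 2) else 0) * z F = _
    simp only [Finset.sum_mul]
    rw [Finset.sum_comm]
    simp
  have hdot : ∀ (y : G.edgeSet → ZMod 2) z,
      M.mulVec y ⬝ᵥ z = ∑ d : G.Dart, z (R.left d) * y (toEdge d) := by
    intro y z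
    rw [← Matrix.vecMul_transpose, ← Matrix.dotProduct_mulVec,
      ← Finset.sum_fiberwise Finset.univ toEdge]
    refine Finset.sum_congr rfl fun e _ => ?_
    rw [hMT, Finset.mul_sum]
    refine Finset.sum_congr rfl fun d hd => ?_
    rw [← (Finset.mem_filter.1 hd).2, mul_comm]
  have hker : ∀ y : G.edgeSet → ZMod 2, (∀ z : R.untwisted.Face → ZMod 2,
      ∑ d : G.Dart, z (R.left d) * y (toEdge d) = 0) → y ∈ LinearMap.ker M.mulVecLin := by
    intro y hy
    rw [LinearMap.mem_ker, Matrix.mulVecLin_apply]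
    refine dotProduct_eq_zero _ fun z => ?_
    rw [hdot, hy]
  have hle : LinearMap.range N.mulVecLin ≤ LinearMap.ker M.mulVecLin := by
    rintro _ ⟨s, rfl⟩
    refine hker _ fun z => ?_
    simp only [Matrix.mulVecLin_apply, hN, mul_add, Finset.sum_add_distrib]
    have : ∑ d : G.Dart, z (R.left d) * s d.fst = ∑ d : G.Dart, z (R.left d) * s d.snd := by
      rw [← Equiv.sum_comp R.facePerm]
      simp only [left_facePerm, facePerm_fst]
    rw [this, CharTwo.add_self_eq_zero]
  have hk1 : Module.finrank (ZMod 2) (LinearMap.ker N.mulVecLin) ≤ 1 := by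
    refine finrank_ker_le_one _ fun s hs u v => ?_
    obtain ⟨p⟩ := hconn.preconnected u v
    induction p with
    | nil => rfl
    | cons h p ih =>
      rw [← ih]
      have := congrFun hs (toEdge ⟨(_, _), h⟩)
      rw [Matrix.mulVecLin_apply, hN] at this
      exact CharTwo.add_eq_zero.1 this
  have hk2 : Module.finrank (ZMod 2) (LinearMap.ker M.transpose.mulVecLin) ≤ 1 := by
    refine finrank_ker_le_one _ fun z hz F F' => ?_
    obtain ⟨d, rfl⟩ := R.left_surjective F
    obtain ⟨d', rfl⟩ := R.left_surjective F'
    have h2 : ∀ d : G.Dart, z (R.left d.symm) = z (R.left d) := by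
      intro d
      have := congrFun hz (toEdge d)
      rw [Matrix.mulVecLin_apply, hMT, sum_darts_over_edge] at this
      exact (CharTwo.add_eq_zero.1 this).symm
    exact R.eq_of_forall_rot_symm hconn (z := fun d => z (R.left d))
      (fun d => by rw [left_rot, h2]) h2 d d'
  have hn1 := LinearMap.finrank_range_add_finrank_ker N.mulVecLin
  have hn2 := LinearMap.finrank_range_add_finrank_ker M.transpose.mulVecLin
  have hn3 := LinearMap.finrank_range_add_finrank_ker M.mulVecLin
  have hrank := M.rank_transpose
  rw [Matrix.rank, Matrix.rank] at hrank
  rw [Module.finrank_fintype_fun_eq_card, ← Nat.card_eq_fintype_card] at hn1 hn2 hn3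
  have heuler := hR.2
  rw [Embedding.eulerChar] at heuler
  -- The rank of `N` is at least `|V| - 1`, while the kernel of `M` has dimension at most `|E| - |F|
  -- + 1`, the same number by Euler's formula.
  have hEq : LinearMap.range N.mulVecLin = LinearMap.ker M.mulVecLin :=
    Submodule.eq_of_le_of_finrank_le hle (by push_cast at heuler; omega)
  obtain ⟨s, hs⟩ : (fun e : G.edgeSet => c e) ∈ LinearMap.range N.mulVecLin := by
    rw [hEq]
    exact hker _ hc
  refine ⟨s, fun d => ?_⟩
  rw [← hN, ← Matrix.mulVecLin_apply, hs]
  rfl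

/-- A family of edges whose dual edges form a closed walk is the coboundary of a function. -/
theorem exists_potential_of_dual_cycle [DecidableEq V] (hconn : G.Connected) (hR : R.IsPlanar) {n : ℕ}
    (e : Fin n → G.Dart) (π : Equiv.Perm (Fin n))
    (he : ∀ i, R.left (e i).symm = R.left (e (π i))) :
    ∃ s : V → ZMod 2, ∀ d : G.Dart,
      (∑ i, if d.edge = (e i).edge then 1 else 0) = s d.fst + s d.snd := by
  refine R.exists_potential hconn hR (fun x => ∑ i, if x = (e i).edge then 1 else 0) ?_
  intro z
  simp only [Finset.mul_sum]
  rw [Finset.sum_comm]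
  have : ∀ i, ∑ d : G.Dart, z (R.left d) * (if d.edge = (e i).edge then 1 else 0) =
      z (R.left (e i)) + z (R.left (e (π i))) := by
    intro i
    simp only [mul_ite, mul_one, mul_zero]
    rw [← Finset.sum_filter, Dart.edge_fiber, Finset.sum_pair (e i).symm_ne.symm, he]
  simp only [this, Finset.sum_add_distrib]
  -- The permutation matches the second sides of the edges with the first ones, so everything
  -- cancels modulo two.
  rw [Equiv.sum_comp π (fun i => z (R.left (e i))), CharTwo.add_self_eq_zero]

/-- Three pairwise adjacent cells, or two cells with two common edges, or a cell that meets itself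
along an edge: in a cyclically `4`-edge connected cubic planar graph only the first happens, and
only around a vertex. -/
theorem star_of_dual_cycle (hconn : G.Connected) (hcubic : G.IsRegularOfDegree 3)
    (hcyc : CyclicallyEdgeConnected G 4) (hR : R.IsPlanar) {n : ℕ} (hn0 : 0 < n) (hn : n ≤ 3)
    (e : Fin n → G.Dart) (π : Equiv.Perm (Fin n))
    (he : ∀ i, R.left (e i).symm = R.left (e (π i)))
    (hinj : Function.Injective fun i => (e i).edge) : n = 3 ∧ ∃ v, ∀ i, v ∈ (e i).edge := by
  classical
  obtain ⟨s, hs⟩ := R.exists_potential_of_dual_cycle hconn hR e π he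
  have hX : ∀ d : G.Dart, d.edge ∈ Finset.univ.image (fun i => (e i).edge) ↔
      s d.fst ≠ s d.snd := by
    intro d
    rw [← not_iff_not, not_not, ← CharTwo.add_eq_zero, ← hs]
    by_cases h : ∃ i, (e i).edge = d.edge
    · obtain ⟨i, hi⟩ := h
      have : ∀ j, d.edge = (e j).edge ↔ i = j := fun j => by
        rw [← hi]; exact hinj.eq_iff
      simpa [this] using ⟨i, hi⟩
    · have h' : ∀ i, d.edge ≠ (e i).edge := fun i hi => h ⟨i, hi.symm⟩
      simp [h', fun i => (h' i).symm]
  have hcard : (Finset.univ.image fun i => (e i).edge).card = n := by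
    rw [Finset.card_image_of_injective _ hinj, Finset.card_univ, Fintype.card_fin]
  obtain ⟨h1, v, hv⟩ := eq_star_of_cut hcubic hcyc (X := Finset.univ.image fun i => (e i).edge)
    (by intro x hx; obtain ⟨i, -, rfl⟩ := Finset.mem_image.1 hx; exact (e i).edge_mem)
    ⟨_, Finset.mem_image_of_mem _ (Finset.mem_univ ⟨0, hn0⟩)⟩ (by omega) s hX
  exact ⟨by omega, v, fun i => hv _ (Finset.mem_image_of_mem _ (Finset.mem_univ i))⟩

end Homology

/-! ### Simplicity of the dual and its triangles. -/

/-- The dual graph has no loops and no multiple edges, and each of its triangles comes from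
three edges with a common end. -/
structure HasSimpleDual : Prop where
  left_ne : ∀ d : G.Dart, R.left d ≠ R.left d.symm
  left_inj : ∀ d d' : G.Dart, R.left d = R.left d' → R.left d.symm = R.left d'.symm → d = d'
  star : ∀ a b c : G.Dart, R.left a.symm = R.left b → R.left b.symm = R.left c →
    R.left c.symm = R.left a → ∃ v, v ∈ a.edge ∧ v ∈ b.edge ∧ v ∈ c.edge

theorem hasSimpleDual [Fintype V] [DecidableRel G.Adj] (hconn : G.Connected)
    (hcubic : G.IsRegularOfDegree 3) (hcyc : CyclicallyEdgeConnected G 4) (hR : R.IsPlanar) :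
    R.HasSimpleDual := by
  have hA : ∀ d : G.Dart, R.left d ≠ R.left d.symm := by
    intro d h
    have := R.star_of_dual_cycle hconn hcubic hcyc hR one_pos (by omega) (fun _ => d) 1
      (fun _ => h.symm) (Function.injective_of_subsingleton _)
    omega
  refine ⟨hA, fun d d' h1 h2 => ?_, fun a b c hab hbc hca => ?_⟩
  · by_contra hne
    have hedge : d.edge ≠ d'.edge := by
      intro h
      rcases (dart_edge_eq_iff d d').1 h with h | rfl
      · exact hne h
      · exact hA d' h1.symm
    -- Cross from one cell to the other through `d` and return through `d'`.
    have := R.star_of_dual_cycle hconn hcubic hcyc hR two_pos (by omega) ![d, d'.symm]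
      (Equiv.swap 0 1) (by
        rw [Fin.forall_fin_two]
        exact ⟨h2, by simpa using h1.symm⟩) (by
        intro i j
        fin_cases i <;> fin_cases j <;> simp [hedge, hedge.symm])
    omega
  · have hne : ∀ a b c : G.Dart, R.left a.symm = R.left b → R.left b.symm = R.left c →
        R.left c.symm = R.left a → a.edge ≠ b.edge := by
      intro a b c hab hbc hca h
      rcases (dart_edge_eq_iff a b).1 h with rfl | rfl
      · exact hA _ hab.symm
      · exact hA c (hbc.symm.trans hca.symm)
    have h1 := hne a b c hab hbc hca
    have h2 := hne b c a hbc hca hab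
    have h3 := hne c a b hca hab hbc
    obtain ⟨-, v, hv⟩ := R.star_of_dual_cycle hconn hcubic hcyc hR three_pos le_rfl ![a, b, c]
      (finRotate 3) (by
        intro i
        fin_cases i
        · exact hab
        · exact hbc
        · exact hca) (by
        intro i j
        fin_cases i <;> fin_cases j <;> simp [h1, h2, h3, h1.symm, h2.symm, h3.symm])
    exact ⟨v, hv 0, hv 1, hv 2⟩

end RotationSystem

/-! ### Reversing the rotations along `f`. -/

namespace RotationSystem
variable {V : Type*} {G : SimpleGraph V} (R : RotationSystem G)

/-- The vertex `v` lies on the boundary of the cell `f`. -/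
def OnFace (f : R.untwisted.Face) (v : V) : Prop := ∃ a : G.Dart, R.left a = f ∧ a.fst = v

open Classical in
/-- The orientation of the vertices in which those on the boundary of `f` are reversed. -/
noncomputable def flip (f : R.untwisted.Face) (v : V) : ℤˣ := if R.OnFace f v then -1 else 1

/-- The face permutation after the rotations at the vertices of `f` have been reversed. -/
noncomputable def flipPerm (f : R.untwisted.Face) : Equiv.Perm G.Dart :=
  R.untwisted.faceStep (R.flip f)

variable {R} {f : R.untwisted.Face}

theorem onFace_fst {a : G.Dart} (ha : R.left a = f) : R.OnFace f a.fst := ⟨a, ha, rfl⟩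

theorem left_facePerm_of {a : G.Dart} (ha : R.left a = f) : R.left (R.facePerm a) = f := by
  rw [left_facePerm, ha]

theorem onFace_snd {a : G.Dart} (ha : R.left a = f) : R.OnFace f a.snd :=
  ⟨R.facePerm a, left_facePerm_of ha, R.facePerm_fst a⟩

theorem exists_facePerm_eq {a : G.Dart} (ha : R.left a = f) :
    ∃ b, R.left b = f ∧ R.facePerm b = a := by
  refine ⟨R.facePerm⁻¹ a, ?_, by rw [← Equiv.Perm.mul_apply, mul_inv_cancel, Equiv.Perm.one_apply]⟩
  rw [← R.left_facePerm, ← Equiv.Perm.mul_apply, mul_inv_cancel, Equiv.Perm.one_apply, ha]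

theorem flipPerm_of_not_onFace {d : G.Dart} (h : ¬ R.OnFace f d.snd) :
    R.flipPerm f d = R.facePerm d := by
  rw [flipPerm, Embedding.faceStep_apply, flip, if_neg h]
  rfl

section Cubic
variable [Fintype V] [DecidableRel G.Adj] (hcubic : G.IsRegularOfDegree 3)
include hcubic

theorem flipPerm_of_onFace {d : G.Dart} (h : R.OnFace f d.snd) :
    R.flipPerm f d = R.rot (R.rot d.symm) := by
  rw [flipPerm, Embedding.faceStep_apply, flip, if_pos h, Units.val_neg, Units.val_one,
    zpow_neg, zpow_one]
  exact R.rot_inv_eq hcubic _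

theorem flipPerm_of_left_eq {a : G.Dart} (ha : R.left a = f) :
    R.flipPerm f a = R.rot (R.facePerm a) :=
  flipPerm_of_onFace hcubic (onFace_snd ha)

theorem flipPerm_symm {b : G.Dart} (hb : R.left b = f) :
    R.flipPerm f (R.facePerm b).symm = b.symm := by
  have h : R.OnFace f (R.facePerm b).symm.snd := onFace_fst (left_facePerm_of hb)
  rw [flipPerm_of_onFace hcubic h, Dart.symm_symm, facePerm_apply, R.rot_rot_rot hcubic]

theorem flipPerm_rot_symm {a : G.Dart} (ha : R.left a = f) :
    R.flipPerm f (R.rot a).symm = a := by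
  have h : R.OnFace f (R.rot a).symm.snd := ⟨a, ha, (R.rot_fst a).symm⟩
  rw [flipPerm_of_onFace hcubic h, Dart.symm_symm, R.rot_rot_rot hcubic]

/-- For `b` on `f`, the dart `rot (facePerm b)` is the third one at the end of `b`. It separates the
cell across `b` from the cell across `facePerm b`. -/
theorem left_rot_facePerm_symm (b : G.Dart) :
    R.left (R.rot (R.facePerm b)).symm = R.left b.symm := by
  rw [← left_rot, facePerm_apply, R.rot_rot_rot hcubic]

/-- The three kinds of darts that start at a vertex of `f`. -/
theorem left_eq_or_of_onFace {d : G.Dart} (h : R.OnFace f d.fst) :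
    R.left d = f ∨ R.left d.symm = f ∨ ∃ b, R.left b = f ∧ d = R.rot (R.facePerm b) := by
  obtain ⟨a, ha, hfst⟩ := h
  rcases R.eq_or_eq_rot_or_rot_eq hcubic hfst.symm with h | h | h
  · exact .inl (h ▸ ha)
  · obtain ⟨b, hb, rfl⟩ := exists_facePerm_eq ha
    exact .inr (.inr ⟨b, hb, h⟩)
  · refine .inr (.inl ?_)
    rw [← left_rot, h, ha]

variable (hS : R.HasSimpleDual)
include hS

/-- Otherwise two consecutive darts at the vertex would have the same left cell, which would then
lie on both sides of an edge. -/
theorem eq_of_left_eq_of_fst_eq {a a' : G.Dart} (h : R.left a = R.left a')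
    (hfst : a.fst = a'.fst) : a = a' := by
  rcases R.eq_or_eq_rot_or_rot_eq hcubic hfst with h' | h' | h'
  · exact h'
  · rw [h', left_rot] at h
    exact absurd h.symm (hS.left_ne a')
  · rw [← h', left_rot] at h
    exact absurd h (hS.left_ne a)

omit hcubic [Fintype V] [DecidableRel G.Adj] in
theorem eq_of_left_symm_eq {a a' : G.Dart} (ha : R.left a = f) (ha' : R.left a' = f)
    (h : R.left a.symm = R.left a'.symm) : a = a' :=
  hS.left_inj _ _ (ha.trans ha'.symm) h

/-- An edge that leaves a vertex of `f` without being on `f` ends outside `f`. -/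
theorem not_onFace_rot_snd (h2 : ∀ a, R.left a = f → R.facePerm (R.facePerm a) ≠ a)
    {a : G.Dart} (ha : R.left a = f) : ¬ R.OnFace f (R.rot a).snd := by
  obtain ⟨b, hb, rfl⟩ := exists_facePerm_eq ha
  intro h
  have h1 := R.left_rot (R.facePerm b)
  have h3 := left_rot_facePerm_symm hcubic (R := R) b
  rcases left_eq_or_of_onFace hcubic (d := (R.rot (R.facePerm b)).symm) h with h | h | ⟨b', hb', h⟩
  · exact hS.left_ne b (by rw [hb, ← h3, h])
  · rw [Dart.symm_symm] at h
    exact hS.left_ne (R.facePerm b) (by rw [← h1, h, ha])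
  -- Here the edge leaves `f` at both ends. Comparing its two sides forces `f` to have length two,
  -- as the dual has no parallel edges.
  · have h4 := R.left_rot (R.facePerm b')
    have h5 := left_rot_facePerm_symm hcubic (R := R) b'
    rw [← h, h3] at h4
    rw [← h, Dart.symm_symm, h1] at h5
    have h6 := eq_of_left_symm_eq hS hb (left_facePerm_of hb') h4
    have h7 := eq_of_left_symm_eq hS ha hb' h5
    exact h2 b hb (by rw [h7, ← h6])

end Cubic

/-! ### Labels of the new cells. -/

section Labels
variable (p : G.Dart → ZMod 2)

/-- The cells that are neither `f` nor adjacent to `f`. -/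
def FarFace (f : R.untwisted.Face) : Type _ :=
  {g : R.untwisted.Face // g ≠ f ∧ ∀ a, R.left a = f → g ≠ R.left a.symm}

open Classical in
/-- The cell to which a dart belongs after the rotations at the vertices of `f` have been
reversed: the mirror image of `f`, one of the two cells made from the neighbours of `f`, or a cell
far from `f`. Here `p` two-colours the darts along `f`. -/
noncomputable def label (f : R.untwisted.Face) (d : G.Dart) : Option (ZMod 2) ⊕ FarFace f :=
  if h₁ : R.left d = f then .inl (some (p d))
  else if R.left d.symm = f then .inl none
  else if h : ∃ a, R.left a = f ∧ R.left d = R.left a.symm then .inl (some (p h.choose + 1))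
  else .inr ⟨R.left d, h₁, fun a ha ha' => h ⟨a, ha, ha'⟩⟩

variable {p}

theorem label_of_left_eq {d : G.Dart} (h : R.left d = f) : label p f d = .inl (some (p d)) := by
  simp [label, h]

variable (hS : R.HasSimpleDual)
include hS

theorem label_of_left_symm_eq {d : G.Dart} (h : R.left d.symm = f) :
    label p f d = .inl none := by
  have : R.left d ≠ f := fun h' => hS.left_ne d (h'.trans h.symm)
  simp [label, this, h]

theorem label_of_near {a d : G.Dart} (h2 : R.left d.symm ≠ f) (ha : R.left a = f)
    (h : R.left d = R.left a.symm) : label p f d = .inl (some (p a + 1)) := by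
  have h1 : R.left d ≠ f := fun h' => hS.left_ne a (by rw [ha, ← h, h'])
  have hex : ∃ a, R.left a = f ∧ R.left d = R.left a.symm := ⟨a, ha, h⟩
  -- The choice in `label` is forced: a neighbour of `f` shares only one edge with `f`.
  have : hex.choose = a :=
    eq_of_left_symm_eq hS hex.choose_spec.1 ha (by rw [← hex.choose_spec.2, h])
  rw [label, dif_neg h1, if_neg h2, dif_pos hex, this]

omit hS in
theorem label_of_far {d : G.Dart} (h1 : R.left d ≠ f)
    (h : ∀ a, R.left a = f → R.left d ≠ R.left a.symm) :
    label p f d = .inr ⟨R.left d, h1, h⟩ := by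
  have h2 : R.left d.symm ≠ f := fun h' => h _ h' (by simp)
  have hex : ¬ ∃ a, R.left a = f ∧ R.left d = R.left a.symm := fun ⟨a, ha, ha'⟩ => h a ha ha'
  rw [label, dif_neg h1, if_neg h2, dif_neg hex]

variable [Fintype V] [DecidableRel G.Adj] (hcubic : G.IsRegularOfDegree 3)
  (hp : ∀ a, R.left a = f → p (R.facePerm a) = p a + 1)
include hcubic hp

/-- After `b` the new walk continues along the neighbour across `facePerm b`. The shift by one in
`label` cancels the change of colour from `b` to `facePerm b`. -/
theorem label_rot_facePerm {b : G.Dart} (hb : R.left b = f) :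
    label p f (R.rot (R.facePerm b)) = .inl (some (p b)) := by
  rw [label_of_near hS (a := R.facePerm b) ?_ (left_facePerm_of hb) (R.left_rot _), hp _ hb,
    add_assoc, CharTwo.add_self_eq_zero, add_zero]
  rw [left_rot_facePerm_symm hcubic]
  exact fun h => hS.left_ne b (hb.trans h.symm)

/-- The two permutations differ only at a vertex of `f`, which `d` reaches backwards along `f`,
forwards along `f`, or through the third edge. -/
theorem label_flipPerm (d : G.Dart) : label p f (R.flipPerm f d) = label p f d := by
  by_cases hd : R.OnFace f d.snd
  · rcases left_eq_or_of_onFace hcubic (d := d.symm) hd with h | h | ⟨b, hb, h⟩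
    · obtain ⟨b, hb, hbd⟩ := exists_facePerm_eq h
      obtain rfl : d = (R.facePerm b).symm := by rw [hbd, Dart.symm_symm]
      rw [flipPerm_symm hcubic hb, label_of_left_symm_eq hS h, label_of_left_symm_eq hS]
      rwa [Dart.symm_symm]
    · rw [Dart.symm_symm] at h
      rw [flipPerm_of_left_eq hcubic h, label_rot_facePerm hS hcubic hp h, label_of_left_eq h]
    · have hb' := left_facePerm_of hb
      obtain rfl : d = (R.rot (R.facePerm b)).symm := by rw [← h, Dart.symm_symm]
      rw [flipPerm_rot_symm hcubic hb', label_of_left_eq hb',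
        label_of_near hS (a := b) ?_ hb (left_rot_facePerm_symm hcubic b), hp _ hb]
      rw [Dart.symm_symm, left_rot, ← hb']
      exact (hS.left_ne _).symm
  · have h1 : R.left d ≠ f := fun h => hd (onFace_snd h)
    have h2 : R.left d.symm ≠ f := fun h => hd (onFace_fst h)
    have h3 : R.left (R.facePerm d).symm ≠ f := fun h => hd (by
      rw [← R.facePerm_fst]
      exact onFace_snd h)
    rw [flipPerm_of_not_onFace hd]
    by_cases hex : ∃ a, R.left a = f ∧ R.left d = R.left a.symm
    · obtain ⟨a, ha, had⟩ := hex
      rw [label_of_near hS h2 ha had, label_of_near hS h3 ha (by rw [left_facePerm, had])]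
    · have hex' : ∀ a, R.left a = f → R.left d ≠ R.left a.symm := fun a ha h => hex ⟨a, ha, h⟩
      rw [label_of_far h1 hex', label_of_far (by rwa [left_facePerm])
        (by rwa [left_facePerm])]
      congr 2
      exact R.left_facePerm d

theorem label_eq_of_sameCycle {d d' : G.Dart} (h : (R.flipPerm f).SameCycle d d') :
    label p f d = label p f d' := by
  obtain ⟨n, rfl⟩ := h.exists_nat_pow_eq
  clear h
  induction n with
  | zero => rfl
  | succ n ih => rw [pow_succ', Equiv.Perm.mul_apply, label_flipPerm hS hcubic hp, ih]

/-- The labels belong to the two sides of one edge. The critical case is that both sides are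
neighbours of `f`: with `f` they form a dual triangle, so their edges on `f` share a vertex, are
consecutive, and have opposite colours. -/
theorem label_rot_ne (d : G.Dart) : label p f (R.rot d) ≠ label p f d := by
  have hne : ∀ q : ZMod 2, q + 1 ≠ q := by decide
  by_cases h1 : R.left d = f
  · obtain ⟨b, hb, rfl⟩ := exists_facePerm_eq h1
    rw [label_rot_facePerm hS hcubic hp hb, label_of_left_eq h1, hp _ hb]
    simp
  by_cases h2 : R.left d.symm = f
  · rw [label_of_left_eq (by rwa [left_rot]), label_of_left_symm_eq hS h2]
    simp
  have h4 : R.left (R.rot d) ≠ f := by rwa [left_rot]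
  by_cases h3 : R.left (R.rot d).symm = f
  · rw [label_of_left_symm_eq hS h3]
    by_cases hex : ∃ a, R.left a = f ∧ R.left d = R.left a.symm
    · obtain ⟨a, ha, had⟩ := hex
      rw [label_of_near hS h2 ha had]
      simp
    · rw [label_of_far h1 fun a ha h => hex ⟨a, ha, h⟩]
      simp
  by_cases hex : ∃ a, R.left a = f ∧ R.left d = R.left a.symm <;>
    by_cases hex' : ∃ a, R.left a = f ∧ R.left (R.rot d) = R.left a.symm
  · obtain ⟨a, ha, had⟩ := hex
    obtain ⟨a', ha', had'⟩ := hex'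
    rw [label_of_near hS h2 ha had, label_of_near hS h3 ha' had']
    rw [left_rot] at had'
    have hcase : a' = R.facePerm a ∨ a = R.facePerm a' := by
      have hinj : ∀ a a' : G.Dart, R.left a = f → R.left a' = f → a.fst = a'.fst → a = a' :=
        fun a a' ha ha' => eq_of_left_eq_of_fst_eq hcubic hS (ha.trans ha'.symm)
      have haa : a ≠ a' := by
        rintro rfl
        exact hS.left_ne d (had.trans had'.symm)
      obtain ⟨v, hv, -, hv'⟩ := hS.star a d a'.symm had.symm had'
        (by rw [Dart.symm_symm, ha, ha'])
      rw [Dart.edge_symm] at hv'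
      rcases Sym2.mem_iff.1 hv with rfl | rfl <;> rcases Sym2.mem_iff.1 hv' with h | h
      · exact absurd (hinj _ _ ha ha' h) haa
      · exact .inr (hinj _ _ ha (left_facePerm_of ha') (by rw [facePerm_fst, h]))
      · exact .inl (hinj _ _ ha' (left_facePerm_of ha) (by rw [facePerm_fst, h]))
      · refine absurd (R.facePerm.injective ?_) haa
        exact hinj _ _ (left_facePerm_of ha) (left_facePerm_of ha')
          (by rw [facePerm_fst, facePerm_fst, h])
    rcases hcase with rfl | rfl
    · rw [hp _ ha]
      simp
    · rw [hp _ ha']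
      simp
  · obtain ⟨a, ha, had⟩ := hex
    rw [label_of_near hS h2 ha had, label_of_far h4 fun a ha h => hex' ⟨a, ha, h⟩]
    simp
  · obtain ⟨a, ha, had⟩ := hex'
    rw [label_of_near hS h3 ha had, label_of_far h1 fun a ha h => hex ⟨a, ha, h⟩]
    simp
  · rw [label_of_far h1 fun a ha h => hex ⟨a, ha, h⟩,
      label_of_far h4 fun a ha h => hex' ⟨a, ha, h⟩]
    intro h
    have : R.left (R.rot d) = R.left d := congrArg Subtype.val (Sum.inr.inj h)
    exact hS.left_ne d (this.symm.trans (R.left_rot d))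

theorem eq_of_sameCycle_flipPerm {d d' : G.Dart} (h : (R.flipPerm f).SameCycle d d')
    (hfst : d.fst = d'.fst) : d = d' := by
  have hl := label_eq_of_sameCycle hS hcubic hp h
  rcases R.eq_or_eq_rot_or_rot_eq hcubic hfst with h' | h' | h'
  · exact h'
  · rw [h'] at hl
    exact absurd hl (label_rot_ne hS hcubic hp d')
  · rw [← h'] at hl
    exact absurd hl.symm (label_rot_ne hS hcubic hp d)

end Labels
end RotationSystem

/-! ### Counting the new cells. -/

namespace RotationSystem
variable {V : Type*} {G : SimpleGraph V} {R : RotationSystem G} {f : R.untwisted.Face}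

theorem facePerm_pow_add {p : G.Dart → ZMod 2}
    (hp : ∀ a, R.left a = f → p (R.facePerm a) = p a + 1) {a : G.Dart} (ha : R.left a = f)
    (n : ℕ) : R.left ((R.facePerm ^ n) a) = f ∧ p ((R.facePerm ^ n) a) = p a + n := by
  induction n with
  | zero => simp [ha]
  | succ n ih =>
    rw [pow_succ', Equiv.Perm.mul_apply, left_facePerm, hp _ ih.1, ih.2]
    exact ⟨ih.1, by push_cast; ring⟩

section Count
variable [Fintype V] [DecidableRel G.Adj] (hcubic : G.IsRegularOfDegree 3)
include hcubic

theorem sameCycle_flipPerm_symm {a a' : G.Dart} (ha : R.left a = f) (ha' : R.left a' = f) :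
    (R.flipPerm f).SameCycle a.symm a'.symm := by
  obtain ⟨n, rfl⟩ := (R.left_eq_iff.1 (ha.trans ha'.symm)).exists_nat_pow_eq
  clear ha'
  induction n with
  | zero => exact .rfl
  | succ n ih =>
    have h : R.left ((R.facePerm ^ n) a) = f := by
      rw [← ha, left_eq_iff, Equiv.Perm.sameCycle_pow_left]
    rw [pow_succ', Equiv.Perm.mul_apply]
    refine ih.trans (Equiv.Perm.SameCycle.symm ?_)
    rw [← Equiv.Perm.sameCycle_apply_left, flipPerm_symm hcubic h]

variable (hS : R.HasSimpleDual)
include hS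

/-- Follow the old boundary of the neighbour. It agrees with the new walk away from `f`. -/
theorem sameCycle_flipPerm_of_near {b d : G.Dart} (hb : R.left b = f)
    (h : R.left d = R.left (R.facePerm b).symm) (hd : R.left d.symm ≠ f) :
    (R.flipPerm f).SameCycle b d := by
  have hb' := left_facePerm_of hb
  obtain ⟨n, hn⟩ := (R.left_eq_iff.1 h.symm).exists_nat_pow_eq
  -- The dart shared with `f` is exempt, since it now belongs to the mirror image of `f`.
  have key : ∀ n : ℕ, (R.facePerm ^ n) (R.facePerm b).symm = (R.facePerm b).symm ∨
      (R.flipPerm f).SameCycle b ((R.facePerm ^ n) (R.facePerm b).symm) := by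
    intro n
    induction n with
    | zero => exact .inl rfl
    | succ n ih =>
      have hleft : R.left ((R.facePerm ^ n) (R.facePerm b).symm) = R.left (R.facePerm b).symm := by
        rw [left_eq_iff, Equiv.Perm.sameCycle_pow_left]
      rw [pow_succ', Equiv.Perm.mul_apply]
      generalize (R.facePerm ^ n) (R.facePerm b).symm = e at ih hleft
      have hstart : (R.flipPerm f).SameCycle b (R.facePerm (R.facePerm b).symm) := by
        rw [R.facePerm_apply (R.facePerm b).symm, Dart.symm_symm, ← flipPerm_of_left_eq hcubic hb,
          Equiv.Perm.sameCycle_apply_right]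
      rcases ih with rfl | ih
      · exact .inr hstart
      by_cases hon : R.OnFace f e.snd
      · rcases left_eq_or_of_onFace hcubic (d := e.symm) hon with h' | h' | ⟨c, hc, h'⟩
        · have : e.symm = R.facePerm b := eq_of_left_symm_eq hS h' hb' (by rw [Dart.symm_symm, hleft])
          rw [← this, Dart.symm_symm] at hstart
          exact .inr hstart
        · rw [Dart.symm_symm, hleft] at h'
          exact absurd (hb'.trans h'.symm) (hS.left_ne _)
        -- The walk arrives at `f` through a third edge, so the old boundary closes up at its
        -- starting dart.
        · have h3 := left_rot_facePerm_symm hcubic (R := R) c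
          rw [← h', Dart.symm_symm, hleft] at h3
          obtain rfl := eq_of_left_symm_eq hS hb' hc h3
          left
          rw [facePerm_apply, h', R.facePerm_apply (R.facePerm b), R.rot_rot_rot hcubic]
      · rw [← flipPerm_of_not_onFace hon, Equiv.Perm.sameCycle_apply_right]
        exact .inr ih
  rcases key n with h' | h'
  · rw [hn] at h'
    rw [h', Dart.symm_symm] at hd
    exact absurd hb' hd
  · rwa [hn] at h'

/-- The new walk goes around the neighbour across `facePerm b` and re-enters `f` at the far end of
that edge. -/
theorem sameCycle_flipPerm_facePerm_facePerm {b : G.Dart} (hb : R.left b = f) :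
    (R.flipPerm f).SameCycle b (R.facePerm (R.facePerm b)) := by
  have hb' := left_facePerm_of hb
  have hb'' := left_facePerm_of hb'
  rw [← flipPerm_rot_symm hcubic hb'', Equiv.Perm.sameCycle_apply_right]
  refine sameCycle_flipPerm_of_near hcubic hS hb (left_rot_facePerm_symm hcubic _) ?_
  rw [Dart.symm_symm, left_rot, ← hb'']
  exact (hS.left_ne _).symm

omit hS in
theorem sameCycle_flipPerm_of_far {d d' : G.Dart} (h1 : R.left d ≠ f)
    (h2 : ∀ a, R.left a = f → R.left d ≠ R.left a.symm) (h : R.left d = R.left d') :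
    (R.flipPerm f).SameCycle d d' := by
  obtain ⟨n, rfl⟩ := (R.left_eq_iff.1 h).exists_nat_pow_eq
  clear h
  induction n with
  | zero => exact .rfl
  | succ n ih =>
    have hleft : R.left ((R.facePerm ^ n) d) = R.left d := by
      rw [left_eq_iff, Equiv.Perm.sameCycle_pow_left]
    rw [pow_succ', Equiv.Perm.mul_apply]
    generalize (R.facePerm ^ n) d = e at ih hleft
    rw [← flipPerm_of_not_onFace, Equiv.Perm.sameCycle_apply_right]
    · exact ih
    · intro hon
      rcases left_eq_or_of_onFace hcubic (d := e.symm) hon with h' | h' | ⟨c, hc, h'⟩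
      · exact h2 _ h' (by rw [Dart.symm_symm, hleft])
      · exact h1 (by rw [← hleft, ← h', Dart.symm_symm])
      · have h3 := left_rot_facePerm_symm hcubic (R := R) c
        rw [← h', Dart.symm_symm, hleft] at h3
        exact h2 c hc h3

variable {p : G.Dart → ZMod 2} (hp : ∀ a, R.left a = f → p (R.facePerm a) = p a + 1)
include hp

theorem sameCycle_flipPerm_of_color_eq {a a' : G.Dart} (ha : R.left a = f) (ha' : R.left a' = f)
    (h : p a = p a') : (R.flipPerm f).SameCycle a a' := by
  obtain ⟨n, rfl⟩ := (R.left_eq_iff.1 (ha.trans ha'.symm)).exists_nat_pow_eq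
  -- Equal colours mean an even distance along `f`.
  rw [(facePerm_pow_add hp ha n).2, left_eq_add, ZMod.natCast_eq_zero_iff] at h
  obtain ⟨m, rfl⟩ := h
  clear ha'
  induction m with
  | zero => exact .rfl
  | succ m ih =>
    rw [show 2 * (m + 1) = 2 * m + 1 + 1 by ring, pow_succ', pow_succ', Equiv.Perm.mul_apply,
      Equiv.Perm.mul_apply]
    exact ih.trans (sameCycle_flipPerm_facePerm_facePerm hcubic hS (facePerm_pow_add hp ha _).1)

omit hp in
/-- Every dart is labelled by the mirror image of `f`, or lies in the same cycle as a dart of `f`,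
or is labelled by a far cell. -/
theorem label_trichotomy (d : G.Dart) :
    R.left d.symm = f ∨ (∃ a, R.left a = f ∧ (R.flipPerm f).SameCycle a d) ∨
      (R.left d ≠ f ∧ ∀ a, R.left a = f → R.left d ≠ R.left a.symm) := by
  by_cases h1 : R.left d = f
  · exact .inr (.inl ⟨d, h1, .rfl⟩)
  by_cases h2 : R.left d.symm = f
  · exact .inl h2
  by_cases hex : ∃ a, R.left a = f ∧ R.left d = R.left a.symm
  · obtain ⟨a, ha, had⟩ := hex
    obtain ⟨b, hb, rfl⟩ := exists_facePerm_eq ha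
    exact .inr (.inl ⟨b, hb, sameCycle_flipPerm_of_near hcubic hS hb had h2⟩)
  · exact .inr (.inr ⟨h1, fun a ha h => hex ⟨a, ha, h⟩⟩)

theorem sameCycle_flipPerm_iff (d d' : G.Dart) :
    (R.flipPerm f).SameCycle d d' ↔ label p f d = label p f d' := by
  refine ⟨label_eq_of_sameCycle hS hcubic hp, fun h => ?_⟩
  have hl : ∀ {a d}, R.left a = f → (R.flipPerm f).SameCycle a d →
      label p f d = .inl (some (p a)) := fun ha h => by
    rw [← label_eq_of_sameCycle hS hcubic hp h, label_of_left_eq ha]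
  rcases label_trichotomy hcubic hS d with h1 | ⟨a, ha, h1⟩ | ⟨h1, h2⟩ <;>
  rcases label_trichotomy hcubic hS d' with h1' | ⟨a', ha', h1'⟩ | ⟨h1', h2'⟩
  · simpa using sameCycle_flipPerm_symm hcubic h1 h1'
  · rw [label_of_left_symm_eq hS h1, hl ha' h1'] at h
    simp at h
  · rw [label_of_left_symm_eq hS h1, label_of_far h1' h2'] at h
    simp at h
  · rw [label_of_left_symm_eq hS h1', hl ha h1] at h
    simp at h
  · rw [hl ha h1, hl ha' h1'] at h
    have h : p a = p a' := by simpa using h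
    exact h1.symm.trans ((sameCycle_flipPerm_of_color_eq hcubic hS hp ha ha' h).trans h1')
  · rw [hl ha h1, label_of_far h1' h2'] at h
    simp at h
  · rw [label_of_left_symm_eq hS h1', label_of_far h1 h2] at h
    simp at h
  · rw [hl ha' h1', label_of_far h1 h2] at h
    simp at h
  · rw [label_of_far h1 h2, label_of_far h1' h2'] at h
    exact sameCycle_flipPerm_of_far hcubic h1 h2 (congrArg Subtype.val (Sum.inr.inj h))

omit [Fintype V] [DecidableRel G.Adj] hcubic in
theorem label_surjective : Function.Surjective (label p f) := by
  obtain ⟨a, ha⟩ := R.left_surjective f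
  rintro ((_ | q) | ⟨g, hg1, hg2⟩)
  · exact ⟨a.symm, label_of_left_symm_eq hS (by simpa using ha)⟩
  · have : ∀ x q : ZMod 2, x = q ∨ x + 1 = q := by decide
    rcases this (p a) q with rfl | rfl
    · exact ⟨a, label_of_left_eq ha⟩
    · exact ⟨R.facePerm a, by rw [label_of_left_eq (left_facePerm_of ha), hp _ ha]⟩
  · obtain ⟨d, rfl⟩ := R.left_surjective g
    exact ⟨d, label_of_far hg1 hg2⟩

omit [DecidableRel G.Adj] hcubic hp in
-- Different edges of `f` lead to different neighbours, so there are as many neighbours as boundary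
-- darts.
theorem card_face_eq_add_farFace :
    Nat.card R.untwisted.Face = 1 + {a | R.left a = f}.ncard + Nat.card (FarFace f) := by
  classical
  set T : Set R.untwisted.Face := insert f ((fun a => R.left a.symm) '' {a | R.left a = f})
    with hT
  have h1 : T.ncard = 1 + {a | R.left a = f}.ncard := by
    rw [hT, Set.ncard_insert_of_notMem, Set.InjOn.ncard_image, add_comm]
    · exact fun a ha a' ha' h => eq_of_left_symm_eq hS ha ha' h
    · rintro ⟨a, ha, h⟩
      exact hS.left_ne a (ha.trans h.symm)
  have h2 : Nat.card (FarFace f) = Tᶜ.ncard := by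
    rw [← Nat.card_coe_set_eq]
    refine Nat.card_congr (Equiv.subtypeEquivRight fun g => ?_)
    simp only [hT, Set.mem_compl_iff, Set.mem_insert_iff, Set.mem_image, Set.mem_ofPred_eq, not_or,
      not_exists, not_and, ne_eq, eq_comm (a := g)]
  rw [← h1, h2, Set.ncard_add_ncard_compl]

end Count

/-! ### The length and the two-colouring of a boundary. -/

section Boundary
variable [Finite V] (a : G.Dart)

theorem ncard_left_eq :
    {b | R.left b = R.left a}.ncard = Function.minimalPeriod R.facePerm a := by
  classical
  have := Fintype.ofFinite V
  have himage : {b | R.left b = R.left a} =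
      (fun n => R.facePerm^[n] a) '' Set.Iio (Function.minimalPeriod R.facePerm a) := by
    have hpos := Function.minimalPeriod_pos_of_mem_periodicPts
      (R.facePerm.injective.mem_periodicPts a)
    ext b
    constructor
    · intro hb
      obtain ⟨n, rfl⟩ := (R.left_eq_iff.1 (show R.left b = R.left a from hb).symm).exists_nat_pow_eq
      refine ⟨n % Function.minimalPeriod R.facePerm a, Nat.mod_lt _ hpos, ?_⟩
      simp only [Function.iterate_mod_minimalPeriod_eq, Equiv.Perm.iterate_eq_pow]
    · rintro ⟨n, -, rfl⟩
      simp only [Set.mem_ofPred_eq, left_eq_iff, Equiv.Perm.iterate_eq_pow,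
        Equiv.Perm.sameCycle_pow_left]
      exact .rfl
  rw [himage, Function.iterate_injOn_Iio_minimalPeriod.ncard_image]
  simp [Set.ncard_eq_toFinset_card']

omit [Finite V] in
-- The position along the boundary is well defined modulo an even period, hence has a parity.
theorem exists_color {k : ℕ} (hk : Function.minimalPeriod R.facePerm a = 2 * k) :
    ∃ p : G.Dart → ZMod 2, ∀ b, R.left b = R.left a → p (R.facePerm b) = p b + 1 := by
  classical
  have hex : ∀ b, R.left b = R.left a → ∃ n : ℤ, (R.facePerm ^ n) a = b := fun b hb =>
    R.left_eq_iff.1 hb.symm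
  have huniq : ∀ m n : ℤ, (R.facePerm ^ m) a = (R.facePerm ^ n) a → (m : ZMod 2) = n := by
    intro m n h
    have h1 : (R.facePerm ^ (m - n)) • a = a := by
      rw [Equiv.Perm.smul_def, sub_eq_neg_add, zpow_add, Equiv.Perm.mul_apply, h,
        ← Equiv.Perm.mul_apply, ← zpow_add]
      simp
    rw [MulAction.zpow_smul_eq_iff_minimalPeriod_dvd] at h1
    have h2 : ((2 * k : ℕ) : ℤ) ∣ m - n := by
      rw [← hk]
      exact h1
    rw [← sub_eq_zero, ← Int.cast_sub, ZMod.intCast_zmod_eq_zero_iff_dvd]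
    exact (Dvd.intro _ (by push_cast; rfl)).trans h2
  refine ⟨fun b => if h : R.left b = R.left a then ((hex b h).choose : ZMod 2) else 0,
    fun b hb => ?_⟩
  have hb' : R.left (R.facePerm b) = R.left a := by rw [left_facePerm, hb]
  beta_reduce
  rw [dif_pos hb, dif_pos hb', ← Int.cast_one, ← Int.cast_add]
  refine huniq _ _ ?_
  rw [(hex _ hb').choose_spec, add_comm, zpow_one_add, Equiv.Perm.mul_apply,
    (hex _ hb).choose_spec]

end Boundary
end RotationSystem

/-! ### The dual cycle around `f` and the signature it defines. -/

namespace RotationSystem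
variable {V : Type*} {G : SimpleGraph V} {R : RotationSystem G} {f : R.untwisted.Face}

theorem dual_adj_iff (hS : R.HasSimpleDual) {g : R.untwisted.Face} :
    R.untwisted.dual.Adj f g ↔ ∃ b, R.left b = f ∧ g = R.left b.symm := by
  constructor
  · rintro ⟨-, ⟨d, ε⟩, rfl, rfl⟩
    rcases Int.units_eq_one_or ε with rfl | rfl
    · exact ⟨d, rfl, R.face_neg d⟩
    · exact ⟨d.symm, (R.face_neg d).symm, by simp [Embedding.otherSide, left]⟩
  · rintro ⟨b, rfl, rfl⟩
    exact ⟨hS.left_ne b, (b, 1), rfl, R.face_neg b⟩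

/-- A state on the negative side traverses the boundary backwards and so interchanges the two cells;
this is why `P` must be symmetric. -/
theorem exists_state_iff {P : R.untwisted.Face → R.untwisted.Face → Prop}
    (hP : ∀ g h, P g h ↔ P h g) :
    (∃ x : G.Dart × ℤˣ, R.untwisted.face x = f ∧
      P (R.untwisted.face (Embedding.otherSide x))
        (R.untwisted.face (Embedding.otherSide (R.untwisted.next x)))) ↔
    ∃ b, R.left b = f ∧ P (R.left b.symm) (R.left (R.facePerm b).symm) := by
  have hnext : ∀ d : G.Dart, R.untwisted.next (d, 1) = (R.facePerm d, 1) := fun d => rfl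
  have hnext' : ∀ b : G.Dart, R.untwisted.next ((R.facePerm b).symm, -1) = (b.symm, -1) := by
    intro b
    have h : R.untwisted.sgn (R.facePerm b).symm = 1 := rfl
    rw [Embedding.next, h, mul_one, Dart.symm_symm, Units.val_neg, Units.val_one, zpow_neg,
      zpow_one]
    refine Prod.ext ?_ rfl
    exact Equiv.Perm.inv_eq_iff_eq.2 (R.facePerm_apply b)
  constructor
  · rintro ⟨⟨d, ε⟩, rfl, h⟩
    rcases Int.units_eq_one_or ε with rfl | rfl
    · rw [hnext] at h
      simp only [Embedding.otherSide, face_neg] at h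
      exact ⟨d, rfl, h⟩
    · obtain ⟨b, hb, hbd⟩ := exists_facePerm_eq (R.face_neg d).symm
      obtain rfl : d = (R.facePerm b).symm := by rw [hbd, Dart.symm_symm]
      rw [hnext'] at h
      simp only [Embedding.otherSide, neg_neg] at h
      exact ⟨b, hb, (hP _ _).1 h⟩
  · rintro ⟨b, rfl, h⟩
    refine ⟨(b, 1), rfl, ?_⟩
    rw [hnext]
    simpa only [Embedding.otherSide, face_neg] using h

section Cubic
variable [Fintype V] [DecidableRel G.Adj] (hcubic : G.IsRegularOfDegree 3)
  (hS : R.HasSimpleDual) (h2 : ∀ a, R.left a = f → R.facePerm (R.facePerm a) ≠ a)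
include hcubic hS h2

omit h2 in
theorem dual_adj_consecutive (b : G.Dart) :
    R.untwisted.dual.Adj (R.left b.symm) (R.left (R.facePerm b).symm) := by
  rw [dual_adj_iff hS]
  refine ⟨(R.rot (R.facePerm b)).symm, left_rot_facePerm_symm hcubic b, ?_⟩
  rw [Dart.symm_symm, left_rot]

omit h2 in
theorem link_adj_iff {g h : R.untwisted.Face} :
    (R.untwisted.link f).Adj g h ↔
      ∃ b, R.left b = f ∧ s(g, h) = s(R.left b.symm, R.left (R.facePerm b).symm) := by
  have hiff := exists_state_iff (f := f) (P := fun g' h' => s(g, h) = s(g', h'))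
    fun g' h' => by rw [Sym2.eq_swap (a := g')]
  constructor
  · rintro ⟨-, -, -, h⟩
    exact hiff.1 h
  · rintro ⟨b, hb, he⟩
    have h1 : R.untwisted.dual.Adj f (R.left b.symm) := (dual_adj_iff hS).2 ⟨b, hb, rfl⟩
    have h3 : R.untwisted.dual.Adj f (R.left (R.facePerm b).symm) :=
      (dual_adj_iff hS).2 ⟨_, left_facePerm_of hb, rfl⟩
    have h4 := dual_adj_consecutive hcubic hS b
    have h5 := hiff.2 ⟨b, hb, he⟩
    rcases Sym2.eq_iff.1 he with ⟨rfl, rfl⟩ | ⟨rfl, rfl⟩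
    · exact ⟨h1, h3, h4, h5⟩
    · exact ⟨h3, h1, h4.symm, h5⟩

theorem exists_eq_rot_facePerm_iff {d : G.Dart} :
    (∃ b, R.left b = f ∧ d = R.rot (R.facePerm b)) ↔
      R.OnFace f d.fst ∧ ¬ R.OnFace f d.snd := by
  constructor
  · rintro ⟨b, hb, rfl⟩
    exact ⟨⟨R.facePerm b, left_facePerm_of hb, (R.rot_fst _).symm⟩,
      not_onFace_rot_snd hcubic hS h2 (left_facePerm_of hb)⟩
  · rintro ⟨h, h'⟩
    rcases left_eq_or_of_onFace hcubic h with h1 | h1 | h1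
    · exact absurd (onFace_snd h1) h'
    · exact absurd (onFace_fst h1) h'
    · exact h1

/-- Consecutive neighbours of `f` are the two sides of a third edge at a vertex of `f`. In a simple
dual the two sides determine the edge, and third edges are those with exactly one end on `f`. -/
theorem link_adj_left_iff (d : G.Dart) :
    (R.untwisted.link f).Adj (R.left d) (R.left d.symm) ↔
      (R.OnFace f d.fst ↔ ¬ R.OnFace f d.snd) := by
  have h1 := exists_eq_rot_facePerm_iff hcubic hS h2 (d := d)
  have h3 := exists_eq_rot_facePerm_iff hcubic hS h2 (d := d.symm)
  have hfst : d.symm.fst = d.snd := rfl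
  have hsnd : d.symm.snd = d.fst := rfl
  rw [hfst, hsnd] at h3
  have h4 : (R.untwisted.link f).Adj (R.left d) (R.left d.symm) ↔
      (∃ b, R.left b = f ∧ d = R.rot (R.facePerm b)) ∨
        ∃ b, R.left b = f ∧ d.symm = R.rot (R.facePerm b) := by
    rw [link_adj_iff hcubic hS, ← exists_or]
    refine exists_congr fun b => ?_
    rw [← and_or_left]
    refine and_congr_right fun hb => ?_
    have h5 := R.left_rot (R.facePerm b)
    have h6 := left_rot_facePerm_symm hcubic (R := R) b
    rw [← h5, ← h6, Sym2.eq_iff, or_comm]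
    refine or_congr ⟨fun h => hS.left_inj _ _ h.1 h.2, fun h => by rw [h]; exact ⟨rfl, rfl⟩⟩
      ⟨fun h => hS.left_inj _ _ h.2 (by rw [Dart.symm_symm]; exact h.1), fun h => ?_⟩
    rw [← h, Dart.symm_symm]
    exact ⟨rfl, rfl⟩
  rw [h4, h1, h3]
  tauto

theorem sgn_twist_link (d : G.Dart) :
    (R.twist (R.untwisted.link f)).sgn d = R.flip f d.fst * R.flip f d.snd := by
  classical
  have hiff : (∃ d' : G.Dart, d'.edge = d.edge ∧
      (R.untwisted.link f).Adj (R.untwisted.face (d', 1)) (R.untwisted.face (d', -1))) ↔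
      (R.OnFace f d.fst ↔ ¬ R.OnFace f d.snd) := by
    rw [← link_adj_left_iff hcubic hS h2]
    constructor
    · rintro ⟨d', he, h⟩
      rw [face_neg] at h
      rcases (dart_edge_eq_iff d' d).1 he with rfl | rfl
      · exact h
      · rw [Dart.symm_symm] at h
        exact h.symm
    · intro h
      exact ⟨d, rfl, by rwa [face_neg]⟩
  have hsgn : (R.twist (R.untwisted.link f)).sgn d =
      if (R.OnFace f d.fst ↔ ¬ R.OnFace f d.snd) then -1 else 1 := by
    rw [← if_congr hiff rfl rfl]
    simp only [Embedding.sgn, twist]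
    congr
  rw [hsgn, flip, flip]
  by_cases h1 : R.OnFace f d.fst <;> by_cases h3 : R.OnFace f d.snd <;> simp [h1, h3]

end Cubic

/-- The cells around `f` form a cycle of the dual graph. -/
theorem exists_isCycle_link [Fintype V] [DecidableRel G.Adj] (hcubic : G.IsRegularOfDegree 3)
    (hS : R.HasSimpleDual) (a : G.Dart)
    (h3 : 3 ≤ Function.minimalPeriod R.facePerm a) :
    ∃ (u : R.untwisted.Face) (c : R.untwisted.dual.Walk u u), c.IsCycle ∧
      c.length = Function.minimalPeriod R.facePerm a ∧
      c.toSubgraph = R.untwisted.link (R.left a) := by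
  have hleft : ∀ i, R.left (R.facePerm^[i] a) = R.left a := fun i => by
    rw [Equiv.Perm.iterate_eq_pow, left_eq_iff, Equiv.Perm.sameCycle_pow_left]
  let s : ℕ → R.untwisted.dual.Dart := fun i =>
    ⟨(R.left (R.facePerm^[i] a).symm, R.left (R.facePerm (R.facePerm^[i] a)).symm),
      dual_adj_consecutive hcubic hS _⟩
  obtain ⟨c, hc, hd⟩ := exists_isCycle_darts s
    (fun i => by simp only [s, Function.iterate_succ_apply']) h3
    (by simp only [s, Function.iterate_minimalPeriod]; rfl) (by
      intro i hi j hj hij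
      exact (Function.iterate_eq_iterate_iff_of_lt_minimalPeriod hi hj).1
        (eq_of_left_symm_eq hS (hleft i) (hleft j) hij))
  have hlen : c.length = Function.minimalPeriod R.facePerm a := by
    rw [← Walk.length_darts, hd]; simp
  have hpos : 0 < Function.minimalPeriod R.facePerm a := by omega
  have hface : ∀ b, R.left b = R.left a ↔
      ∃ i < Function.minimalPeriod R.facePerm a, R.facePerm^[i] a = b := by
    intro b
    constructor
    · intro hb
      obtain ⟨n, rfl⟩ := (R.left_eq_iff.1 hb.symm).exists_nat_pow_eq
      exact ⟨n % Function.minimalPeriod R.facePerm a, Nat.mod_lt _ hpos, by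
        rw [Function.iterate_mod_minimalPeriod_eq, Equiv.Perm.iterate_eq_pow]⟩
    · rintro ⟨i, -, rfl⟩
      exact hleft i
  refine ⟨_, c, hc, hlen, Subgraph.ext ?_ ?_⟩
  · ext g
    rw [Walk.mem_verts_toSubgraph, ← Walk.cons_map_snd_darts, hd]
    change _ ↔ R.untwisted.dual.Adj (R.left a) g
    rw [dual_adj_iff hS]
    simp only [List.mem_cons, List.mem_map, List.mem_range, s, exists_exists_and_eq_and]
    constructor
    · rintro (rfl | ⟨i, hi, rfl⟩)
      · exact ⟨a, rfl, rfl⟩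
      · exact ⟨_, left_facePerm_of (hleft i), rfl⟩
    · rintro ⟨b, hb, rfl⟩
      obtain ⟨b', hb', rfl⟩ := exists_facePerm_eq hb
      obtain ⟨i, hi, rfl⟩ := (hface b').1 hb'
      exact .inr ⟨i, hi, rfl⟩
  · ext g h
    rw [Walk.adj_toSubgraph_iff_mem_edges, Walk.edges, hd, link_adj_iff hcubic hS]
    simp only [List.mem_map, List.mem_range, exists_exists_and_eq_and]
    constructor
    · rintro ⟨i, hi, he⟩
      exact ⟨_, hleft i, he.symm⟩
    · rintro ⟨b, hb, he⟩
      obtain ⟨i, hi, rfl⟩ := (hface b).1 hb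
      exact ⟨i, hi, he.symm⟩

end RotationSystem
end StrongEmb

/-! ### Conclusion. -/

theorem mainTheorem7 {V : Type*} [Fintype V] (G : SimpleGraph V) [DecidableRel G.Adj]
    (hconn : G.Connected) (hcubic : G.IsRegularOfDegree 3)
    (hcyc : StrongEmb.CyclicallyEdgeConnected G 4)
    (R : StrongEmb.RotationSystem G) (hR : R.IsPlanar)
    (k : ℕ) (hk : 2 ≤ k)
    (x : G.Dart × ℤˣ) (hx : (R.untwisted.facialWalk x).length = 2 * k) :
    (∃ (u : R.untwisted.Face) (c : R.untwisted.dual.Walk u u), c.IsCycle ∧ c.length = 2 * k ∧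
      c.toSubgraph = R.untwisted.link (R.untwisted.face x)) ∧
    (R.twist (R.untwisted.link (R.untwisted.face x))).IsStrong ∧
    (R.twist (R.untwisted.link (R.untwisted.face x))).IsOrientableOfGenus (k - 1) := by
  have hS := R.hasSimpleDual hconn hcubic hcyc hR
  rw [R.face_eq_left]
  rw [StrongEmb.Embedding.facialWalk, List.length_map, List.length_iterate,
    StrongEmb.Embedding.minimalPeriod_next (o := fun _ => 1) R.sgn_untwisted] at hx
  -- The given state may traverse `f` in either sense; only its positive dart matters from here on.
  generalize StrongEmb.Embedding.posDart (fun _ => 1) x = a at hx ⊢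
  replace hx : Function.minimalPeriod R.facePerm a = 2 * k := hx
  -- The boundary has `2k ≥ 4` darts, so no dart on it has period two.
  have h2 : ∀ b, R.left b = R.left a → R.facePerm (R.facePerm b) ≠ b := by
    intro b hb h
    have h3 := StrongEmb.RotationSystem.ncard_left_eq (R := R) b
    rw [hb, StrongEmb.RotationSystem.ncard_left_eq, hx] at h3
    have h4 := Function.IsPeriodicPt.minimalPeriod_le (f := R.facePerm) (n := 2) two_pos
      (show R.facePerm^[2] b = b from h)
    omega
  obtain ⟨p, hp⟩ := StrongEmb.RotationSystem.exists_color a hx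
  have ho := StrongEmb.RotationSystem.sgn_twist_link hcubic hS h2
  refine ⟨?_, ?_, ⟨_, ho⟩, ?_⟩
  · rw [← hx]
    exact StrongEmb.RotationSystem.exists_isCycle_link hcubic hS a (by omega)
  · exact StrongEmb.Embedding.isStrong_of_injective hcubic ho fun d d' h hfst =>
      StrongEmb.RotationSystem.eq_of_sameCycle_flipPerm hS hcubic hp h hfst
  · have h1 := StrongEmb.Embedding.card_face_eq ho _
      (StrongEmb.RotationSystem.label_surjective hS hp)
      (StrongEmb.RotationSystem.sameCycle_flipPerm_iff hcubic hS hp)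
    have h3 := StrongEmb.RotationSystem.card_face_eq_add_farFace hS (f := R.left a)
    rw [StrongEmb.RotationSystem.ncard_left_eq, hx] at h3
    have hfin : Finite (StrongEmb.RotationSystem.FarFace (R.left a)) := Subtype.finite
    have h4 : Nat.card (Option (ZMod 2)) = 3 := by simp
    rw [Nat.card_sum, h4] at h1
    have h5 := hR.2
    rw [StrongEmb.Embedding.eulerChar] at h5 ⊢
    rw [h1]
    push_cast [Nat.cast_sub (show 1 ≤ k by omega)]
    -- With `m` far cells, there were `1 + 2k + m` cells and there are now `3 + m`.
    omega
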